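/- Let $n\ge 0$ and $\vec a=(a_1,\dots,a_n)\in\mathbb R_{>0}^n$. Put $H_{\vec a}(z)=\pi\sum_j|z_j|^2/a_j$ on $\mathbb C^n$, $E(\vec a)=\{H_{\vec a}\le 1\}$, $\mathring E(\vec a)=\{H_{\vec a}<1\}$, $\partial E(\vec a)=\{H_{\vec a}=1\}$, $\lambda_{\rm std}=\tfrac12\sum_j(x_jdy_j-y_jdx_j)$, $\omega_{\rm std}=d\lambda_{\rm std}$, and equip $\partial E(\vec a)$ with the contact form $\alpha=\lambda_{\rm std}|_{\partial E(\vec a)}$, with Reeb field $R_\alpha$. Let $\mathcal J(\partial E(\vec a))$ be the set of almost complex structures on $\mathbb R\times\partial E(\vec a)$ which are translation invariant, send $\partial_r$ to $R_\alpha$, and preserve $\xi=\ker\alpha$ and are $d\alpha$-compatible on it. Completions are formed by attaching a half-infinite cylinder, on which the symplectic form is $d(e^r\alpha)$, along a collar trivialized by the flow of the Liouville field $\tfrac12\sum_j(x_j\partial_{x_j}+y_j\partial_{y_j})$: for $X$ with positive (negative) boundary $\partial E(\vec b)$, $\widehat X=X\cup(\mathbb R_{\ge0}\times\partial E(\vec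 b))$ (respectively $\widehat X=X\cup(\mathbb R_{\le0}\times\partial E(\vec b))$). Write $\mathcal J(X)$ (respectively $\mathcal J_{\rm tame}(X)$) for the set of smooth almost complex structures on $\widehat X$ which are compatible with (respectively tamed by) the symplectic form on $X$ and agree on the cylindrical end with the restriction of an element of $\mathcal J(\partial E(\vec b))$. Let $F_{\vec a}:\mathbb R\times\partial E(\vec a)\to\mathbb C^n\setminus\{0\}$, $F_{\vec a}(r,z)=e^{r/2}z$; the Liouville flow identifies $\mathbb R\times\partial E(\vec a)$ with $\widehat E(\vec a)\setminus\{0\}$ and with $\widehat{\mathbb C}^n_{\vec a}$, where $\mathbb C^n_{\vec a}=\mathbb C^n\setminus\mathring E(\vec a)$ is completed at its negative end. (1) There is a diffeomorphism $Q^+_{\vec a}:\widehat E(\vec a)\to\mathbb C^n$ such that $(Q^+_{\vec a})^*i\in\mathcal J_{\rm tame}(E(\vec a))$ and $Q^+_{\vec a}\circ F_{\vec a}^{-1}$ is the identity near $0$. (2) There is a diffeomorphism $Q^-_{\vec a}:\widehat{\mathbb C}^n_{\vec a}\to\mathbb C^n\setminus\{0\}$ such that $(Q^-_{\vec a})^*i\in\mathcal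 J_{\rm tame}(\mathbb C^n_{\vec a})$ and $Q^-_{\vec a}\circ F_{\vec a}^{-1}$ is the identity outside some ball. (3) Let $(M,\omega)$ be a closed symplectic manifold of dimension $2n$, $J$ an $\omega$-compatible almost complex structure, $p_0\in M$, and suppose that $J$ is integrable near $p_0$ and that there are complex coordinates $\zeta$ near $p_0$, $\zeta(p_0)=0$, in which $\omega=\omega_{\rm std}$. Then for all sufficiently small $\varepsilon>0$ the ellipsoid $E(\varepsilon\vec a)$ lies in the image of $\zeta$ and, with $M_{\vec a}:=M\setminus\zeta^{-1}(\mathring E(\varepsilon\vec a))$ completed at its negative end $\partial E(\varepsilon\vec a)$, there is a diffeomorphism $Q:\widehat M_{\vec a}\to M\setminus\{p_0\}$ such that $Q^*J\in\mathcal J(M_{\vec a})$. -/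

import Mathlib

open Set Filter Topology
open scoped Manifold ContDiff

noncomputable section

namespace Ellipsoidal

/-! ### The standard structures on `ℂⁿ` -/

/-- `ℂⁿ` with its Euclidean norm, used throughout as a real vector space of dimension `2n`. -/
abbrev Cn (n : ℕ) : Type := EuclideanSpace ℂ (Fin n)

/-- `H_a(z) = π ∑ |z_j|² / a_j`. -/
def H {n : ℕ} (a : Fin n → ℝ) (z : Cn n) : ℝ := Real.pi * ∑ j, ‖z j‖ ^ 2 / a j

/-- The closed ellipsoid `E(a)`. -/
def ellipsoid {n : ℕ} (a : Fin n → ℝ) : Set (Cn n) := {z | H a z ≤ 1}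

/-- The open ellipsoid. -/
def openEllipsoid {n : ℕ} (a : Fin n → ℝ) : Set (Cn n) := {z | H a z < 1}

/-- The hypersurface `∂E(a)`. -/
def ellipsoidBdry {n : ℕ} (a : Fin n → ℝ) : Set (Cn n) := {z | H a z = 1}

/-- The Liouville form `λ_std = ½ ∑ (x_j dy_j - y_j dx_j)` at `z`, applied to `v`. -/
def lam {n : ℕ} (z v : Cn n) : ℝ := (1 / 2) * ∑ j, ((z j).re * (v j).im - (z j).im * (v j).re)

/-- The symplectic form `ω_std = ∑ dx_j ∧ dy_j`. -/
def stdForm (n : ℕ) : Cn n [⋀^Fin 2]→L[ℝ] ℝ where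
  toFun v := ∑ j, ((v 0 j).re * (v 1 j).im - (v 0 j).im * (v 1 j).re)
  map_update_add' v i x y := by
    rw [← Finset.sum_add_distrib]
    refine Finset.sum_congr rfl fun j _ => ?_
    fin_cases i <;> simp <;> ring
  map_update_smul' v i c x := by
    rw [smul_eq_mul, Finset.mul_sum]
    refine Finset.sum_congr rfl fun j _ => ?_
    fin_cases i <;> simp <;> ring
  map_eq_zero_of_eq' v i j h hij := by
    have h01 : v 0 = v 1 := by
      fin_cases i <;> fin_cases j <;> simp_all
    refine Finset.sum_eq_zero fun k _ => ?_
    rw [h01]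
    ring
  cont := by
    refine continuous_finsetSum _ fun j _ => ?_
    have h0 : Continuous fun v : Fin 2 → Cn n => v 0 j := by fun_prop
    have h1 : Continuous fun v : Fin 2 → Cn n => v 1 j := by fun_prop
    exact ((Complex.continuous_re.comp h0).mul (Complex.continuous_im.comp h1)).sub
      ((Complex.continuous_im.comp h0).mul (Complex.continuous_re.comp h1))

/-- `ω_std = dλ_std` (the coefficients of `λ_std` are linear in `z`). -/
lemma stdForm_eq_dlam {n : ℕ} (v w : Cn n) : stdForm n ![v, w] = lam v w - lam w v := by
  change ∑ j, ((v j).re * (w j).im - (v j).im * (w j).re) = _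
  rw [lam, lam, ← mul_sub, ← Finset.sum_sub_distrib, Finset.mul_sum]
  exact Finset.sum_congr rfl fun j _ => by ring

/-- The standard complex structure `i` on the vector space `ℂⁿ`. -/
def mulI (n : ℕ) : Cn n →L[ℝ] Cn n := Complex.I • ContinuousLinearMap.id ℝ (Cn n)

/-- The map `F(r, z) = e^{r/2} z`, i.e. the time `r` flow of `Z_std = ½ ∑ (x_j ∂_{x_j} + y_j ∂_{y_j})`
applied to `z`. Restricted to `ℝ × ∂E(a)` it is the diffeomorphism `F_a` onto `ℂⁿ ∖ {0}`, which
pulls `λ_std` back to `e^r α`. -/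
def F {n : ℕ} (p : ℝ × Cn n) : Cn n := Real.exp (p.1 / 2) • p.2

/-! ### SFT admissible almost complex structures on the symplectization `ℝ × ∂E(a)` -/

/-- The tangent space `T_z ∂E(a) = ker dH_a(z)`. -/
def bdryTangent {n : ℕ} (a : Fin n → ℝ) (z : Cn n) : Submodule ℝ (Cn n) :=
  LinearMap.ker (fderiv ℝ (H a) z).toLinearMap

/-- The contact hyperplane `ξ_z = ker α_z`, where `α = λ_std|_{∂E(a)}`. -/
def contactPlane {n : ℕ} (a : Fin n → ℝ) (z : Cn n) : Set (Cn n) :=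
  {v | v ∈ bdryTangent a z ∧ lam z v = 0}

/-- `R` is the value at `z` of the Reeb vector field of `α`:
`R ∈ T_z ∂E(a)`, `dα(R, -) = 0`, `α(R) = 1`. -/
structure IsReeb {n : ℕ} (a : Fin n → ℝ) (z R : Cn n) : Prop where
  tangent : R ∈ bdryTangent a z
  ker : ∀ v ∈ bdryTangent a z, stdForm n ![R, v] = 0
  normalized : lam z R = 1

/-- Membership in `𝒥(∂E(a))`. An endomorphism field of `T(ℝ × ∂E(a))` is written as a field `J` of
endomorphisms of `ℝ × ℂⁿ` which preserves `T_{(r,z)}(ℝ × ∂E(a)) = ℝ × T_z ∂E(a)` for `z ∈ ∂E(a)`;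
its other values are irrelevant. (Smooth fields on `ℝ × ∂E(a)` are the restrictions of smooth
fields on the neighbourhood `ℝ × (ℂⁿ ∖ {0})`.) -/
structure IsSFTAdmissible {n : ℕ} (a : Fin n → ℝ)
    (J : ℝ × Cn n → (ℝ × Cn n →L[ℝ] ℝ × Cn n)) : Prop where
  smooth : ContDiffOn ℝ ∞ J (univ ×ˢ {0}ᶜ)
  tangent : ∀ r, ∀ z ∈ ellipsoidBdry a, ∀ u : ℝ × Cn n, u.2 ∈ bdryTangent a z →
    (J (r, z) u).2 ∈ bdryTangent a z
  sq : ∀ r, ∀ z ∈ ellipsoidBdry a, ∀ u : ℝ × Cn n, u.2 ∈ bdryTangent a z →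
    J (r, z) (J (r, z) u) = -u
  /-- invariance under translations in the `ℝ` factor -/
  translation : ∀ r s, ∀ z ∈ ellipsoidBdry a, ∀ u : ℝ × Cn n, u.2 ∈ bdryTangent a z →
    J (r + s, z) u = J (r, z) u
  /-- `J ∂_r = R_α` -/
  reeb : ∀ r, ∀ z ∈ ellipsoidBdry a, ∃ R, IsReeb a z R ∧ J (r, z) (1, 0) = (0, R)
  /-- `J` preserves `ξ` -/
  contact : ∀ r, ∀ z ∈ ellipsoidBdry a, ∀ v ∈ contactPlane a z,
    (J (r, z) (0, v)).1 = 0 ∧ (J (r, z) (0, v)).2 ∈ contactPlane a z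
  /-- `J|_ξ` is `dα`-compatible -/
  invariant : ∀ r, ∀ z ∈ ellipsoidBdry a, ∀ v ∈ contactPlane a z, ∀ w ∈ contactPlane a z,
    stdForm n ![(J (r, z) (0, v)).2, (J (r, z) (0, w)).2] = stdForm n ![v, w]
  positive : ∀ r, ∀ z ∈ ellipsoidBdry a, ∀ v ∈ contactPlane a z, v ≠ 0 →
    0 < stdForm n ![v, (J (r, z) (0, v)).2]

/-! ### Tensors on manifolds of real dimension `2n` (modelled on `ℂⁿ` over `ℝ`) -/

section Manifold

variable {n : ℕ} {M : Type*} [TopologicalSpace M] [ChartedSpace (Cn n) M]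

/-- Fields of endomorphisms of the tangent spaces. -/
abbrev EndField (n : ℕ) (M : Type*) [TopologicalSpace M] [ChartedSpace (Cn n) M] : Type _ :=
  ∀ x : M, TangentSpace 𝓘(ℝ, Cn n) x →L[ℝ] TangentSpace 𝓘(ℝ, Cn n) x

/-- Fields of alternating bilinear forms on the tangent spaces. -/
abbrev TwoForm (n : ℕ) (M : Type*) [TopologicalSpace M] [ChartedSpace (Cn n) M] : Type _ :=
  ∀ x : M, TangentSpace 𝓘(ℝ, Cn n) x [⋀^Fin 2]→L[ℝ] ℝ

/-- The standard complex structure on the manifold `ℂⁿ`. -/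
def stdJ (n : ℕ) : EndField n (Cn n) := fun _ => mulI n

/-- The standard symplectic form on the manifold `ℂⁿ`. -/
def stdOmega (n : ℕ) : TwoForm n (Cn n) := fun _ => stdForm n

/-- Pullback `f^*Ω` of a two-form. -/
def pullbackForm {N : Type*} [TopologicalSpace N] [ChartedSpace (Cn n) N]
    (f : N → M) (Ω : TwoForm n M) : TwoForm n N := fun x =>
  (Ω (f x)).compContinuousLinearMap (mfderiv 𝓘(ℝ, Cn n) 𝓘(ℝ, Cn n) f x)

/-- Pullback `f^*J = (df)⁻¹ ∘ J ∘ df`, for a local diffeomorphism `f`. -/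
def pullbackJ {N : Type*} [TopologicalSpace N] [ChartedSpace (Cn n) N]
    (f : N → M) (J : EndField n M) : EndField n N := fun x =>
  (mfderiv 𝓘(ℝ, Cn n) 𝓘(ℝ, Cn n) f x).inverse ∘L J (f x) ∘L
    mfderiv 𝓘(ℝ, Cn n) 𝓘(ℝ, Cn n) f x

/-- `J` is a (smooth) almost complex structure. -/
structure IsAlmostComplex [IsManifold 𝓘(ℝ, Cn n) ∞ M] (J : EndField n M) : Prop where
  sq : ∀ x v, J x (J x v) = -v
  smooth : ContMDiff 𝓘(ℝ, Cn n) (𝓘(ℝ, Cn n).prod 𝓘(ℝ, Cn n →L[ℝ] Cn n)) ∞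
    (fun x : M => Bundle.TotalSpace.mk' (Cn n →L[ℝ] Cn n)
      (E := fun x : M => TangentSpace 𝓘(ℝ, Cn n) x →L[ℝ] TangentSpace 𝓘(ℝ, Cn n) x) x (J x))

/-- The expression of `Ω` in the chart at `x₀`, a two-form on (an open subset of) `ℂⁿ`. -/
def TwoForm.inChart (Ω : TwoForm n M) (x₀ : M) : Cn n → Cn n [⋀^Fin 2]→L[ℝ] ℝ := fun y =>
  (Ω ((extChartAt 𝓘(ℝ, Cn n) x₀).symm y)).compContinuousLinearMap
    (mfderiv 𝓘(ℝ, Cn n) 𝓘(ℝ, Cn n) (extChartAt 𝓘(ℝ, Cn n) x₀).symm y)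

/-- `Ω` is a symplectic form: smooth, closed and nondegenerate. -/
structure IsSymplecticForm (Ω : TwoForm n M) : Prop where
  smooth : ∀ x₀, ContDiffOn ℝ ∞ (Ω.inChart x₀) (extChartAt 𝓘(ℝ, Cn n) x₀).target
  closed : ∀ x₀, ∀ y ∈ (extChartAt 𝓘(ℝ, Cn n) x₀).target, extDeriv (Ω.inChart x₀) y = 0
  nondegenerate : ∀ x v, (∀ w, Ω x ![v, w] = 0) → v = 0

/-- `J` is tamed by `Ω` at `x`. -/
def TameAt (Ω : TwoForm n M) (J : EndField n M) (x : M) : Prop :=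
  ∀ v, v ≠ 0 → 0 < Ω x ![v, J x v]

/-- `J` is compatible with `Ω` at `x`. -/
def CompatibleAt (Ω : TwoForm n M) (J : EndField n M) (x : M) : Prop :=
  TameAt Ω J x ∧ ∀ v w, Ω x ![J x v, J x w] = Ω x ![v, w]

/-- `ζ` is a smooth chart of `M` centred at `p₀` which is holomorphic for `J` and in which `Ω` is
`ω_std`. In particular `J` is integrable on the domain of `ζ`. -/
structure IsComplexDarbouxChart (Ω : TwoForm n M) (J : EndField n M) (p₀ : M)
    (ζ : OpenPartialHomeomorph M (Cn n)) : Prop where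
  smooth : ζ ∈ IsManifold.maximalAtlas 𝓘(ℝ, Cn n) ∞ M
  mem_source : p₀ ∈ ζ.source
  map_point : ζ p₀ = 0
  holomorphic : ∀ x ∈ ζ.source, ∀ v,
    mfderiv 𝓘(ℝ, Cn n) 𝓘(ℝ, Cn n) ζ x (J x v) = mulI n (mfderiv 𝓘(ℝ, Cn n) 𝓘(ℝ, Cn n) ζ x v)
  darboux : ∀ x ∈ ζ.source, pullbackForm ζ (stdOmega n) x = Ω x

/-- `M ∖ {p₀}` as an open submanifold. -/
def puncture [T1Space M] (p₀ : M) : TopologicalSpace.Opens M := ⟨{p₀}ᶜ, isOpen_compl_singleton⟩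

end Manifold

/-! ### Symplectic completions -/

/-- The data for attaching to a domain `piece ⊆ M` a cylindrical end `I × ∂E(a)`, with `I = ℝ_{≥0}`
or `ℝ_{≤0}`, along the hypersurface `collar (∂E(a))`. Here `times` is `I ∖ {0}`, and `collar` is the
symplectic embedding of (a subset of) `ℂⁿ` which carries `Z_std` to the Liouville vector field near
that hypersurface; so `(r, z) ↦ collar (e^{r/2} z)` is the trivialization by the Liouville flow. -/
structure EndData (n : ℕ) (M : Type*) [TopologicalSpace M] where
  piece : Set M
  times : Set ℝ
  a : Fin n → ℝ
  collar : Cn n → M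
  glue_injective : Function.Injective
    (Sum.elim (fun x : piece => (x : M))
      (fun p : times × ellipsoidBdry a => collar (F ((p.1 : ℝ), (p.2 : Cn n)))))
  glue_isOpen_range : IsOpen (range
    (Sum.elim (fun x : piece => (x : M))
      (fun p : times × ellipsoidBdry a => collar (F ((p.1 : ℝ), (p.2 : Cn n))))))

namespace EndData

section Top

variable {n : ℕ} {M : Type*} [TopologicalSpace M] (D : EndData n M)

/-- The underlying set of the completion: the domain together with the end `I × ∂E(a)`, the points
`(0, z)` of the end being identified with the points `collar z` of the domain. -/
def Completion : Type _ := D.piece ⊕ (D.times × ellipsoidBdry D.a)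

/-- The inclusion of the domain. -/
def incl (x : D.piece) : D.Completion := Sum.inl x

/-- The map which is the inclusion on the domain and the Liouville flow trivialization
`(r, z) ↦ collar (e^{r/2} z)` on the end. The topology, smooth structure and symplectic form of the
completion, obtained by gluing along a collar trivialized by the Liouville flow, are precisely the
ones for which this map is an open symplectic embedding. -/
def glue : D.Completion → M :=
  Sum.elim (fun x : D.piece => (x : M))
    (fun p : D.times × ellipsoidBdry D.a => D.collar (F ((p.1 : ℝ), (p.2 : Cn n))))

instance : TopologicalSpace D.Completion := TopologicalSpace.induced D.glue inferInstance

lemma isOpenEmbedding_glue : IsOpenEmbedding D.glue :=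
  ⟨⟨⟨rfl⟩, D.glue_injective⟩, D.glue_isOpen_range⟩

/-- `glue` as a partial homeomorphism, near a given point of the completion. -/
def gluePH (w : D.Completion) : OpenPartialHomeomorph D.Completion M :=
  haveI : Nonempty D.Completion := ⟨w⟩
  D.isOpenEmbedding_glue.toOpenPartialHomeomorph D.glue

instance [ChartedSpace (Cn n) M] : ChartedSpace (Cn n) D.Completion where
  atlas := {e | ∃ w : D.Completion, ∃ c ∈ atlas (Cn n) M, e = (D.gluePH w).trans c}
  chartAt w := (D.gluePH w).trans (chartAt (Cn n) (D.glue w))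
  mem_chart_source w := by
    simp [gluePH]
  chart_mem_atlas w := ⟨w, _, chart_mem_atlas _ _, rfl⟩

instance [ChartedSpace (Cn n) M] [IsManifold 𝓘(ℝ, Cn n) ∞ M] :
    IsManifold 𝓘(ℝ, Cn n) ∞ D.Completion where
  compatible := by
    rintro _ _ ⟨w, c, hc, rfl⟩ ⟨w', c', hc', rfl⟩
    have hww : D.gluePH w' = D.gluePH w := rfl
    rw [hww, OpenPartialHomeomorph.trans_symm_eq_symm_trans_symm,
      OpenPartialHomeomorph.trans_assoc, ← OpenPartialHomeomorph.trans_assoc (D.gluePH w).symm]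
    have h := (contDiffGroupoid ∞ 𝓘(ℝ, Cn n)).compatible hc hc'
    have hopen := c.symm.isOpen_inter_preimage (D.gluePH w).symm.open_source
    have hs := closedUnderRestriction' h hopen
    refine (contDiffGroupoid ∞ 𝓘(ℝ, Cn n)).mem_of_eqOnSource hs ?_
    refine ⟨?_, ?_⟩
    · have hr : ∀ y, c.symm y ∈ (D.gluePH w).target →
          D.gluePH w ((D.gluePH w).symm (c.symm y)) = c.symm y :=
        fun y hy => (D.gluePH w).right_inv hy
      have hl : ∀ y, c.symm y ∈ (D.gluePH w).target →
          (D.gluePH w).symm (c.symm y) ∈ (D.gluePH w).source :=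
        fun y hy => (D.gluePH w).map_target hy
      rw [OpenPartialHomeomorph.restr_source, hopen.interior_eq]
      ext y
      simp only [OpenPartialHomeomorph.trans_source, OpenPartialHomeomorph.symm_source,
        mem_inter_iff, mem_preimage, OpenPartialHomeomorph.coe_trans, Function.comp_apply]
      constructor
      · rintro ⟨h1, ⟨h2, h3⟩, h4⟩
        rw [hr y h2] at h4
        exact ⟨⟨h1, h4⟩, h1, h2⟩
      · rintro ⟨⟨h1, h4⟩, -, h2⟩
        exact ⟨h1, ⟨h2, hl y h2⟩, by rwa [hr y h2]⟩
    · intro y hy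
      have hy' : c.symm y ∈ range D.glue := by
        simp [gluePH] at hy
        simpa using hy.2.1
      have := (D.gluePH w).right_inv (x := c.symm y) (by simpa [gluePH] using hy')
      simp [this]

end Top

section Admissible

variable {n : ℕ} {M : Type*} [TopologicalSpace M] [ChartedSpace (Cn n) M]
  [IsManifold 𝓘(ℝ, Cn n) ∞ M] (D : EndData n M)

/-- The symplectic form of the completion: `Ω` on the domain, `d(e^r α)` on the end. -/
def form (Ω : TwoForm n M) : TwoForm n D.Completion := pullbackForm D.glue Ω

/-- The differential at `(r, z)` of the embedding of the cylindrical end into the completion, where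
`w` is the image of `(r, z)`. Only its values on `ℝ × T_z ∂E(a)` matter. -/
def endDeriv (r : ℝ) (z : Cn n) (w : D.Completion) :
    ℝ × Cn n →L[ℝ] TangentSpace 𝓘(ℝ, Cn n) w :=
  (mfderiv 𝓘(ℝ, Cn n) 𝓘(ℝ, Cn n) D.glue w).inverse ∘L
    (mfderiv 𝓘(ℝ, ℝ × Cn n) 𝓘(ℝ, Cn n) (fun p => D.collar (F p)) (r, z) :
      ℝ × Cn n →L[ℝ] TangentSpace 𝓘(ℝ, Cn n) (D.glue w))

/-- `J` agrees on the cylindrical end `I × ∂E(a)` (including `r = 0`) with the restriction of an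
element of `𝒥(∂E(a))`. -/
def CylindricalOnEnd (J : EndField n D.Completion) : Prop :=
  ∃ J' : ℝ × Cn n → (ℝ × Cn n →L[ℝ] ℝ × Cn n), IsSFTAdmissible D.a J' ∧
    ∀ r ∈ insert 0 D.times, ∀ z ∈ ellipsoidBdry D.a, ∀ w : D.Completion,
      D.glue w = D.collar (F (r, z)) → ∀ u : ℝ × Cn n, u.2 ∈ bdryTangent D.a z →
        J w (D.endDeriv r z w u) = D.endDeriv r z w (J' (r, z) u)

/-- `J` is SFT admissible on the completion: compatible with the symplectic form on the domain and
cylindrical on the end. -/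
structure MemJ (Ω : TwoForm n M) (J : EndField n D.Completion) : Prop where
  almostComplex : IsAlmostComplex J
  compatible : ∀ x : D.piece, CompatibleAt (D.form Ω) J (D.incl x)
  cylindrical : D.CylindricalOnEnd J

/-- The analogue with tameness in place of compatibility on the domain. -/
structure MemJTame (Ω : TwoForm n M) (J : EndField n D.Completion) : Prop where
  almostComplex : IsAlmostComplex J
  tame : ∀ x : D.piece, TameAt (D.form Ω) J (D.incl x)
  cylindrical : D.CylindricalOnEnd J

end Admissible

end EndData

/-! ### The three completions -/

lemma H_F {n : ℕ} (a : Fin n → ℝ) (r : ℝ) (z : Cn n) : H a (F (r, z)) = Real.exp r * H a z := by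
  have h : Real.exp (r / 2) ^ 2 = Real.exp r := by
    rw [← Real.exp_nat_mul]; congr 1; push_cast; ring
  simp only [H, F, PiLp.smul_apply, norm_smul, Real.norm_eq_abs, Real.abs_exp, mul_pow, h,
    mul_div_assoc, ← Finset.mul_sum]
  ring

lemma F_injOn {n : ℕ} {a : Fin n → ℝ} {r s : ℝ} {z w : Cn n} (hz : H a z = 1) (hw : H a w = 1)
    (h : F (r, z) = F (s, w)) : r = s ∧ z = w := by
  have h1 := congrArg (H a) h
  rw [H_F, H_F, hz, hw, mul_one, mul_one] at h1
  obtain rfl := Real.exp_injective h1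
  exact ⟨rfl, smul_right_injective (Cn n) (Real.exp_pos (r / 2)).ne' h⟩

lemma H_pos {n : ℕ} {a : Fin n → ℝ} (ha : ∀ i, 0 < a i) {z : Cn n} (hz : z ≠ 0) : 0 < H a z := by
  refine mul_pos Real.pi_pos ?_
  obtain ⟨j, hj⟩ : ∃ j, z j ≠ 0 := by
    by_contra! hcon
    exact hz (PiLp.ext hcon)
  refine Finset.sum_pos' (fun i _ => div_nonneg (sq_nonneg _) (ha i).le) ⟨j, Finset.mem_univ _, ?_⟩
  exact div_pos (pow_pos (norm_pos_iff.mpr hj) 2) (ha j)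

lemma H_zero {n : ℕ} (a : Fin n → ℝ) : H a (0 : Cn n) = 0 := by simp [H]

lemma exists_F {n : ℕ} {a : Fin n → ℝ} (ha : ∀ i, 0 < a i) {z : Cn n} (hz : z ≠ 0) :
    ∃ w, H a w = 1 ∧ F (Real.log (H a z), w) = z := by
  have hp := H_pos ha hz
  have hF : F (Real.log (H a z), F (-Real.log (H a z), z)) = z := by
    simp only [F, smul_smul, ← Real.exp_add]
    rw [show Real.log (H a z) / 2 + -Real.log (H a z) / 2 = 0 by ring, Real.exp_zero, one_smul]
  refine ⟨_, ?_, hF⟩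
  rw [H_F, Real.exp_neg, Real.exp_log hp, inv_mul_cancel₀ hp.ne']

/-- The data of the completion `Ê(a) = E(a) ∪ (ℝ_{≥0} × ∂E(a))`. -/
def ellipsoidEnd {n : ℕ} (a : Fin n → ℝ) (ha : ∀ i, 0 < a i) : EndData n (Cn n) where
  piece := ellipsoid a
  times := Ioi 0
  a := a
  collar := id
  glue_injective := by
    refine Function.Injective.sumElim Subtype.val_injective ?_ ?_
    · rintro ⟨⟨r, hr⟩, ⟨z, hz⟩⟩ ⟨⟨s, hs⟩, ⟨w, hw⟩⟩ h
      obtain ⟨rfl, rfl⟩ := F_injOn hz hw h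
      rfl
    · rintro ⟨x, hx⟩ ⟨⟨r, hr⟩, ⟨z, hz⟩⟩ h
      have h1 : x = F (r, z) := h
      have hx' : H a x ≤ 1 := hx
      rw [h1, H_F, show H a z = 1 from hz, mul_one] at hx'
      exact absurd hx' (not_le.mpr (Real.one_lt_exp_iff.mpr hr))
  glue_isOpen_range := by
    rw [range_eq_univ.mpr]
    · exact isOpen_univ
    · intro z
      by_cases hz : H a z ≤ 1
      · exact ⟨Sum.inl ⟨z, hz⟩, rfl⟩
      · have hz0 : z ≠ 0 := by
          rintro rfl
          exact hz ((H_zero a).le.trans zero_le_one)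
        obtain ⟨w, hw, hFw⟩ := exists_F ha hz0
        exact ⟨Sum.inr ⟨⟨_, Real.log_pos (not_le.mp hz)⟩, ⟨w, hw⟩⟩, hFw⟩

/-- The data of the completion at the negative end
`(M ∖ ι(int E(b))) ∪ (ℝ_{≤0} × ∂E(b))`, where `ι = ζ⁻¹|_{E(b)}` for a chart `ζ` of `M` whose image
contains `E(b)`. -/
def complementEnd {n : ℕ} {M : Type*} [TopologicalSpace M] [T1Space M]
    (ζ : OpenPartialHomeomorph M (Cn n)) (b : Fin n → ℝ) (hb : ∀ i, 0 < b i)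
    (hζ : ellipsoid b ⊆ ζ.target) : EndData n M where
  piece := (ζ.symm '' openEllipsoid b)ᶜ
  times := Iio 0
  a := b
  collar := ζ.symm
  glue_injective := by
    have hsub : openEllipsoid b ⊆ ζ.target := fun z (hz : H b z < 1) => hζ (le_of_lt hz)
    have hmem : ∀ r < 0, ∀ z : Cn n, H b z = 1 → F (r, z) ∈ openEllipsoid b := by
      intro r hr z hz
      change H b _ < 1
      rw [H_F, hz, mul_one]
      exact Real.exp_lt_one_iff.mpr hr
    refine Function.Injective.sumElim Subtype.val_injective ?_ ?_
    · rintro ⟨⟨r, hr⟩, ⟨z, hz⟩⟩ ⟨⟨s, hs⟩, ⟨w, hw⟩⟩ h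
      have h' := ζ.symm.injOn (hsub (hmem r hr z hz)) (hsub (hmem s hs w hw)) h
      obtain ⟨rfl, rfl⟩ := F_injOn hz hw h'
      rfl
    · rintro ⟨x, hx⟩ ⟨⟨r, hr⟩, ⟨z, hz⟩⟩ h
      exact hx ⟨F (r, z), hmem r hr z hz, (show x = _ from h).symm⟩
  glue_isOpen_range := by
    have hsub : openEllipsoid b ⊆ ζ.target := fun z (hz : H b z < 1) => hζ (le_of_lt hz)
    have h0 : (0 : Cn n) ∈ openEllipsoid b := by
      change H b 0 < 1
      rw [H_zero]
      exact zero_lt_one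
    convert isOpen_compl_singleton (x := ζ.symm 0) using 1
    ext x
    constructor
    · rintro ⟨⟨x, hx⟩ | ⟨⟨r, hr⟩, ⟨z, hz⟩⟩, rfl⟩
      · rintro rfl
        exact hx ⟨0, h0, rfl⟩
      · intro h
        have hH : H b (F (r, z)) = Real.exp r := by rw [H_F, show H b z = 1 from hz, mul_one]
        have hlt : H b (F (r, z)) ≤ 1 := by rw [hH]; exact Real.exp_le_one_iff.mpr (le_of_lt hr)
        have h' : F (r, z) = 0 := ζ.symm.injOn (hζ hlt) (hsub h0) h
        rw [h', H_zero] at hH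
        exact (Real.exp_pos r).ne hH
    · intro hx
      by_cases hx' : x ∈ ζ.symm '' openEllipsoid b
      · obtain ⟨z, hz, rfl⟩ := hx'
        have hz0 : z ≠ 0 := by
          rintro rfl
          exact hx rfl
        obtain ⟨w, hw, hFw⟩ := exists_F hb hz0
        exact ⟨Sum.inr ⟨⟨_, Real.log_neg (H_pos hb hz0) hz⟩, ⟨w, hw⟩⟩, congrArg ζ.symm hFw⟩
      · exact ⟨Sum.inl ⟨x, hx'⟩, rfl⟩

/-- The data of the completion `(ℂⁿ ∖ int E(a)) ∪ (ℝ_{≤0} × ∂E(a))` at the negative end. -/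
def affineEnd {n : ℕ} (a : Fin n → ℝ) (ha : ∀ i, 0 < a i) : EndData n (Cn n) :=
  complementEnd (OpenPartialHomeomorph.refl (Cn n)) a ha (subset_univ _)

end Ellipsoidal

end

open Ellipsoidal

open Set Filter Topology
open scoped Manifold ContDiff

noncomputable section

namespace Ellipsoidal

open scoped RealInnerProductSpace

/-! ### Pullback of almost complex structures, local inverses, and the gluing map -/

section Manifold

variable {n : ℕ} {M : Type*} [TopologicalSpace M] [ChartedSpace (Cn n) M]
  {N : Type*} [TopologicalSpace N] [ChartedSpace (Cn n) N]

/-! All the diffeomorphisms come from one family of explicit self-maps of ℂⁿ, `stretch a p q`,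
sending x_j to e^{(2π/a_j) p(log H(x)) - q(log |x|)} x_j, where p and q are real functions to be
chosen.

Where p and q vanish the map is the identity. Where p' = q' = 1 it is the right map on a cylindrical
end: in the coordinates (r, z) with x = e^{r/2} z and z in ∂E(a) it reads z_j ↦ e^{2πr/a_j} z_j /
|z|, up to a constant complex linear diagonal factor. Translation in r is then a complex linear
diagonal map. The image of ∂_r multiplied by i is the image of the Reeb vector, and ξ_z is carried,
up to the diagonal factor, onto the complex orthogonal complement of z. So the pullback of i is SFT
admissible there (`stretchDeriv_F`, `endMap_endJ`, `isSFTAdmissible_endJ`).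

In between, the derivative at x ≠ 0 is D N, with D a positive diagonal matrix, hence complex linear,
and N = 1 + U⟨y,·⟩y - V⟨x,·⟩x symmetric, where y_j = (2π/a_j) x_j. The pullback of i is N⁻¹ i N.
Since x and y span a real subspace on which ω_std vanishes, N commutes with N' = -i N i, so N' w is
sent to i N w, and tameness amounts to positivity of N' N = 1 + U Π_y - V Π_x, where Π_y and Π_x are
complex rank one. This holds when p' ≥ 0, q' ≤ 1 and p' > 0 wherever q' = 1 (`rankTwo_pos`).
Invariance of ω_std follows from the same commutation, so the structure is compatible and not merely
tame (`rankTwo_compatible`).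

The same positivity makes the map injective: in the variables |x_j|², the vector with entries log
|φ_j|, φ being the map, is strictly monotone (`stretch_injective`). Surjectivity comes from
properness, openness away from 0 and connectedness of ℂⁿ ∖ {0} (`stretch_surjective`).

It remains to choose p and q. Switching them on away from 0 gives Q⁺ (`exists_profile_near_zero`);
switching them off away from infinity gives Q⁻ (`exists_profile_near_infinity`). The latter map is
the identity outside an explicit ball, so it can be transplanted into any manifold through a
holomorphic Darboux chart containing that ball (`exists_diffeomorph_complement`). The radius of the
ball scales like √ε for E(εa), which gives the statement for closed manifolds. -/

lemma mfderiv_pullbackJ {f : N → M} {J : EndField n M} {x : N}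
    (hf : (mfderiv 𝓘(ℝ, Cn n) 𝓘(ℝ, Cn n) f x).IsInvertible) (v : TangentSpace 𝓘(ℝ, Cn n) x) :
    mfderiv 𝓘(ℝ, Cn n) 𝓘(ℝ, Cn n) f x (pullbackJ f J x v) =
      J (f x) (mfderiv 𝓘(ℝ, Cn n) 𝓘(ℝ, Cn n) f x v) := by
  obtain ⟨e, he⟩ := hf
  simp only [pullbackJ, ← he, ContinuousLinearMap.inverse_equiv,
    ContinuousLinearMap.comp_apply]
  exact e.apply_symm_apply _

/-- The square is computed after applying the injective df. For smoothness, df and J are read in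
trivializations of the tangent bundles: inversion of operators is smooth near an invertible one, and
the trivializations cancel in (df)⁻¹ J df. -/
lemma IsAlmostComplex.pullback [IsManifold 𝓘(ℝ, Cn n) ∞ M] [IsManifold 𝓘(ℝ, Cn n) ∞ N]
    {f : N → M} {J : EndField n M} (hJ : IsAlmostComplex J)
    (hf : ContMDiff 𝓘(ℝ, Cn n) 𝓘(ℝ, Cn n) ∞ f)
    (hf' : ∀ x, (mfderiv 𝓘(ℝ, Cn n) 𝓘(ℝ, Cn n) f x).IsInvertible) :
    IsAlmostComplex (pullbackJ f J) where
  sq x v := by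
    obtain ⟨e, he⟩ := hf' x
    have hinj : Function.Injective (mfderiv 𝓘(ℝ, Cn n) 𝓘(ℝ, Cn n) f x) := by
      rw [← he]; exact e.injective
    apply hinj
    rw [mfderiv_pullbackJ (hf' x), mfderiv_pullbackJ (hf' x), hJ.sq, map_neg]
  smooth := by
    intro x₀
    rw [contMDiffAt_hom_bundle]
    refine ⟨contMDiffAt_id, ?_⟩
    have h1 := ((contMDiffAt_hom_bundle _).1 (hJ.smooth (f x₀))).2.comp x₀ (hf x₀)
    have : IsManifold 𝓘(ℝ, Cn n) 1 M := IsManifold.of_le (n := ∞) (by norm_cast)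
    have : IsManifold 𝓘(ℝ, Cn n) 1 N := IsManifold.of_le (n := ∞) (by norm_cast)
    have h2 : ContMDiffAt 𝓘(ℝ, Cn n) 𝓘(ℝ, Cn n →L[ℝ] Cn n) ∞ (fun x : N ↦
        ContinuousLinearMap.inCoordinates
        (Cn n) (TangentSpace 𝓘(ℝ, Cn n) (M := N)) (Cn n) (TangentSpace 𝓘(ℝ, Cn n) (M := M))
        x₀ x (f x₀) (f x) (mfderiv 𝓘(ℝ, Cn n) 𝓘(ℝ, Cn n) f x)) x₀ :=
      (hf x₀).mfderiv_const (m := ∞) (by norm_cast)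
    have h3 : ContMDiffAt 𝓘(ℝ, Cn n) 𝓘(ℝ, Cn n →L[ℝ] Cn n) ∞
        (ContinuousLinearMap.inverse ∘ (fun x : N ↦ ContinuousLinearMap.inCoordinates
        (Cn n) (TangentSpace 𝓘(ℝ, Cn n) (M := N)) (Cn n) (TangentSpace 𝓘(ℝ, Cn n) (M := M))
        x₀ x (f x₀) (f x) (mfderiv 𝓘(ℝ, Cn n) 𝓘(ℝ, Cn n) f x))) x₀ := by
      apply ContMDiffAt.comp (I' := 𝓘(ℝ, Cn n →L[ℝ] Cn n)) _ _ h2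
      apply ContDiffAt.contMDiffAt
      apply ContinuousLinearMap.IsInvertible.contDiffAt_map_inverse
      rw [ContinuousLinearMap.inCoordinates_eq (FiberBundle.mem_baseSet_trivializationAt' x₀)
        (FiberBundle.mem_baseSet_trivializationAt' (f x₀))]
      exact ContinuousLinearMap.isInvertible_equiv.comp
        ((hf' x₀).comp ContinuousLinearMap.isInvertible_equiv)
    have h4 := (h3.clm_comp h1).clm_comp h2
    refine h4.congr_of_eventuallyEq ?_
    have A : (trivializationAt (Cn n) (TangentSpace 𝓘(ℝ, Cn n)) x₀).baseSet ∈ 𝓝 x₀ :=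
      (trivializationAt _ _ _).open_baseSet.mem_nhds
        (FiberBundle.mem_baseSet_trivializationAt' _)
    have B : f ⁻¹' (trivializationAt (Cn n) (TangentSpace 𝓘(ℝ, Cn n)) (f x₀)).baseSet ∈ 𝓝 x₀ :=
      (hf x₀).continuousAt.preimage_mem_nhds
        ((trivializationAt _ _ _).open_baseSet.mem_nhds
        (FiberBundle.mem_baseSet_trivializationAt' _))
    filter_upwards [A, B] with x hx h'x
    replace h'x : f x ∈ (trivializationAt (Cn n) (TangentSpace 𝓘(ℝ, Cn n)) (f x₀)).baseSet := h'x
    simp only [Function.comp_apply]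
    rw [ContinuousLinearMap.inCoordinates_eq hx h'x, ContinuousLinearMap.inCoordinates_eq hx hx,
      ContinuousLinearMap.inCoordinates_eq h'x h'x]
    simp only [ContinuousLinearMap.inverse_equiv_comp, ContinuousLinearMap.inverse_comp_equiv,
      ContinuousLinearEquiv.symm_symm, pullbackJ]
    refine ContinuousLinearMap.ext fun v => ?_
    simp only [ContinuousLinearMap.comp_apply, ContinuousLinearEquiv.coe_coe,
      ContinuousLinearEquiv.symm_apply_apply]

/-- The inverse function theorem applied to the expression of f in charts. -/
lemma exists_local_inverse [IsManifold 𝓘(ℝ, Cn n) ∞ M] [IsManifold 𝓘(ℝ, Cn n) ∞ N]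
    {f : N → M} {x₀ : N} (hf : ContMDiffAt 𝓘(ℝ, Cn n) 𝓘(ℝ, Cn n) ∞ f x₀)
    (hf' : (mfderiv 𝓘(ℝ, Cn n) 𝓘(ℝ, Cn n) f x₀).IsInvertible) :
    ∃ h : M → N, ContMDiffAt 𝓘(ℝ, Cn n) 𝓘(ℝ, Cn n) ∞ h (f x₀) ∧ ∀ᶠ y in 𝓝 (f x₀), f (h y) = y := by
  set χ := extChartAt 𝓘(ℝ, Cn n) x₀
  set ψ := extChartAt 𝓘(ℝ, Cn n) (f x₀)
  set g : Cn n → Cn n := ψ ∘ f ∘ χ.symm with hg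
  have hgs : ContDiffAt ℝ ∞ g (χ x₀) := by
    have := (contMDiffAt_iff.1 hf).2
    simp only [modelWithCornersSelf_coe, range_id, contDiffWithinAt_univ] at this
    exact this
  obtain ⟨e₀, he⟩ := hf'
  let e : Cn n ≃L[ℝ] Cn n := e₀
  have hgd : HasFDerivAt g (e : Cn n →L[ℝ] Cn n) (χ x₀) := by
    have h1 := (hf.mdifferentiableAt (by simp)).hasMFDerivAt.2
    rw [← he] at h1
    rw [modelWithCornersSelf_coe, range_id] at h1
    have h2 : HasFDerivWithinAt g (e : Cn n →L[ℝ] Cn n) univ (χ x₀) := h1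
    exact h2.hasFDerivAt univ_mem
  set h0 := hgs.localInverse (f' := e) hgd (by simp)
  have h0s : ContDiffAt ℝ ∞ h0 (g (χ x₀)) := hgs.to_localInverse hgd (by simp)
  have hgx : g (χ x₀) = ψ (f x₀) := by simp [hg, χ]
  have h0x : h0 (ψ (f x₀)) = χ x₀ := by
    rw [← hgx]; exact hgs.localInverse_apply_image hgd (by simp)
  have hχs : ContMDiffAt 𝓘(ℝ, Cn n) 𝓘(ℝ, Cn n) ∞ χ.symm (χ x₀) :=
    (contMDiffOn_extChartAt_symm x₀).contMDiffAt (extChartAt_target_mem_nhds x₀)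
  have hcomp : ContMDiffAt 𝓘(ℝ, Cn n) 𝓘(ℝ, Cn n) ∞ (χ.symm ∘ h0 ∘ ψ) (f x₀) := by
    refine ContMDiffAt.comp (I' := 𝓘(ℝ, Cn n)) (f x₀) (by simpa [h0x] using hχs) ?_
    exact ContMDiffAt.comp (I' := 𝓘(ℝ, Cn n)) (f x₀) (by rw [← hgx]; exact h0s.contMDiffAt)
      contMDiffAt_extChartAt
  refine ⟨_, hcomp, ?_⟩
  have hψ : ContinuousAt ψ (f x₀) := continuousAt_extChartAt _
  have e1 : ∀ᶠ y in 𝓝 (f x₀), g (h0 (ψ y)) = ψ y := by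
    have : ∀ᶠ y in 𝓝 (ψ (f x₀)), g (h0 y) = y := by
      have := (hgs.hasStrictFDerivAt' hgd (by simp)).eventually_right_inverse
      rwa [hgx] at this
    exact hψ.eventually this
  have e2 : ∀ᶠ y in 𝓝 (f x₀), f ((χ.symm ∘ h0 ∘ ψ) y) ∈ ψ.source := by
    have hc : ContinuousAt (f ∘ (χ.symm ∘ h0 ∘ ψ)) (f x₀) := by
      refine ContinuousAt.comp ?_ hcomp.continuousAt
      simp only [Function.comp_apply, h0x]
      simpa [χ] using hf.continuousAt
    have : (f ∘ (χ.symm ∘ h0 ∘ ψ)) (f x₀) = f x₀ := by simp [h0x, χ]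
    refine hc.eventually (IsOpen.mem_nhds (isOpen_extChartAt_source _) ?_)
    rw [this]; exact mem_extChartAt_source _
  filter_upwards [e1, e2, extChartAt_source_mem_nhds (I := 𝓘(ℝ, Cn n)) (f x₀)] with y h1 h2 h3
  exact ψ.injOn h2 h3 h1

namespace EndData

variable (D : EndData n M)

/-- The charts of the completion are those of M precomposed with `glue`. Hence the derivative of
`glue` is literally the identity of the model space, and tensors on the completion can be compared
with tensors on M without coordinates. -/
lemma writtenInExtChartAt_glue (w : D.Completion) :
    writtenInExtChartAt 𝓘(ℝ, Cn n) 𝓘(ℝ, Cn n) w D.glue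
      =ᶠ[𝓝 (extChartAt 𝓘(ℝ, Cn n) w w)] id := by
  filter_upwards [extChartAt_target_mem_nhds (I := 𝓘(ℝ, Cn n)) w] with y hy
  set e := extChartAt 𝓘(ℝ, Cn n) w
  have h := e.right_inv hy
  exact h

lemma hasMFDerivAt_glue (w : D.Completion) :
    HasMFDerivAt 𝓘(ℝ, Cn n) 𝓘(ℝ, Cn n) D.glue w (ContinuousLinearMap.id ℝ (Cn n)) := by
  refine ⟨D.isOpenEmbedding_glue.continuous.continuousAt, ?_⟩
  have h : HasFDerivAt (writtenInExtChartAt 𝓘(ℝ, Cn n) 𝓘(ℝ, Cn n) w D.glue)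
      (ContinuousLinearMap.id ℝ (Cn n)) (extChartAt 𝓘(ℝ, Cn n) w w) :=
    (hasFDerivAt_id _).congr_of_eventuallyEq (D.writtenInExtChartAt_glue w)
  exact h.hasFDerivWithinAt

lemma contMDiff_glue : ContMDiff 𝓘(ℝ, Cn n) 𝓘(ℝ, Cn n) ∞ D.glue := by
  intro w
  rw [contMDiffAt_iff]
  refine ⟨D.isOpenEmbedding_glue.continuous.continuousAt, ?_⟩
  simp only [modelWithCornersSelf_coe, range_id, contDiffWithinAt_univ]
  exact contDiffAt_id.congr_of_eventuallyEq (D.writtenInExtChartAt_glue w)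

end EndData

end Manifold

/-! ### Linear algebra: rank two perturbations of the identity and tameness -/

section Linear

variable {n : ℕ}

lemma mulI_apply_apply (v : Cn n) (j : Fin n) : mulI n v j = Complex.I * v j := rfl

lemma inner_eq_sum (v w : Cn n) :
    ⟪v, w⟫ = ∑ j, ((v j).re * (w j).re + (v j).im * (w j).im) := by
  rw [PiLp.inner_apply]
  refine Finset.sum_congr rfl fun j _ => ?_
  rw [Complex.inner]
  simp
  ring

lemma mulI_mulI (v : Cn n) : mulI n (mulI n v) = -v := by
  ext j
  simp [mulI_apply_apply, ← mul_assoc]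

lemma inner_mulI_mulI (v w : Cn n) : ⟪mulI n v, mulI n w⟫ = ⟪v, w⟫ := by
  simp only [inner_eq_sum, mulI_apply_apply]
  exact Finset.sum_congr rfl fun j _ => by simp; ring

lemma inner_mulI_left (v w : Cn n) : ⟪mulI n v, w⟫ = -⟪v, mulI n w⟫ := by
  rw [← inner_mulI_mulI, mulI_mulI, inner_neg_left]

lemma inner_self_mulI (v : Cn n) : ⟪v, mulI n v⟫ = 0 := by
  have h := inner_mulI_left v v
  rw [real_inner_comm] at h
  linarith

lemma stdForm_apply (v w : Cn n) : stdForm n ![v, w] = ⟪mulI n v, w⟫ := by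
  change ∑ j, ((v j).re * (w j).im - (v j).im * (w j).re) = _
  rw [inner_eq_sum]
  exact Finset.sum_congr rfl fun j _ => by simp [mulI_apply_apply]; ring

lemma lam_eq_inner (z v : Cn n) : lam z v = (1 / 2) * ⟪mulI n z, v⟫ := by
  rw [lam, inner_eq_sum]
  congr 1
  exact Finset.sum_congr rfl fun j _ => by simp [mulI_apply_apply]; ring

/-- Coordinatewise multiplication by real numbers. -/
def scale (c : Fin n → ℝ) : Cn n →L[ℝ] Cn n :=
  LinearMap.toContinuousLinearMap
    { toFun := fun z => WithLp.toLp 2 fun j => c j • z j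
      map_add' := fun z w => by ext j; simp
      map_smul' := fun r z => by ext j; simp [mul_left_comm] }

lemma scale_apply (c : Fin n → ℝ) (z : Cn n) (j : Fin n) : scale c z j = c j • z j := rfl

lemma mulI_scale (c : Fin n → ℝ) (z : Cn n) : mulI n (scale c z) = scale c (mulI n z) := by
  ext j
  simp [mulI_apply_apply, scale_apply, mul_left_comm]

lemma inner_scale_left (c : Fin n → ℝ) (v w : Cn n) : ⟪scale c v, w⟫ = ⟪v, scale c w⟫ := by
  simp only [inner_eq_sum, scale_apply]
  exact Finset.sum_congr rfl fun j _ => by simp; ring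

lemma inner_mulI_scale (c : Fin n → ℝ) (z : Cn n) : ⟪z, mulI n (scale c z)⟫ = 0 := by
  have h := inner_mulI_left z (scale c z)
  rw [← inner_scale_left, ← mulI_scale, real_inner_comm] at h
  linarith

lemma scale_inv_scale {c : Fin n → ℝ} (hc : ∀ j, c j ≠ 0) (z : Cn n) :
    scale (fun j => (c j)⁻¹) (scale c z) = z := by
  ext j
  simp [scale_apply, hc j]

lemma scale_injective {c : Fin n → ℝ} (hc : ∀ j, c j ≠ 0) : Function.Injective (scale c) :=
  Function.LeftInverse.injective (scale_inv_scale hc)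

/-- The symmetric operator `1 + U ⟨y, ·⟩ y - V ⟨x, ·⟩ x`. -/
def rankTwo (U V : ℝ) (x y : Cn n) : Cn n →L[ℝ] Cn n :=
  ContinuousLinearMap.id ℝ (Cn n) + U • (innerSL ℝ y).smulRight y
    - V • (innerSL ℝ x).smulRight x

lemma rankTwo_apply (U V : ℝ) (x y v : Cn n) :
    rankTwo U V x y v = v + (U * ⟪y, v⟫) • y - (V * ⟪x, v⟫) • x := by
  simp [rankTwo, mul_smul]

/-- The conjugate `-i N i` of the operator `N = rankTwo U V x y`. -/
lemma conj_rankTwo_apply (U V : ℝ) (x y v : Cn n) :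
    -mulI n (rankTwo U V x y (mulI n v)) =
      v - (U * ⟪y, mulI n v⟫) • mulI n y + (V * ⟪x, mulI n v⟫) • mulI n x := by
  rw [rankTwo_apply, map_sub, map_add, mulI_mulI, map_smul, map_smul]
  abel

section

/-- Conditions under which `rankTwo U V x y` and its conjugate by `i` are commuting positive
definite operators. -/
structure PositivePair (U V : ℝ) (x y : Cn n) : Prop where
  orthogonal : ⟪x, mulI n y⟫ = 0
  inner_pos : 0 < ⟪y, x⟫
  nonneg : 0 ≤ U
  le_one : V * ⟪x, x⟫ ≤ 1
  strict : V * ⟪x, x⟫ < 1 ∨ 0 < U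

variable {U V : ℝ} {x y : Cn n}

/-- The real span of x and y is orthogonal to its image under i, so all cross terms in the product
of N and -i N i vanish. What remains is the identity plus two complex rank one forms. -/
lemma inner_conj_rankTwo (hxy : ⟪x, mulI n y⟫ = 0) (v w : Cn n) :
    ⟪-mulI n (rankTwo U V x y (mulI n v)), rankTwo U V x y w⟫ =
      ⟪v, w⟫ + U * (⟪y, v⟫ * ⟪y, w⟫ + ⟪y, mulI n v⟫ * ⟪y, mulI n w⟫)
        - V * (⟪x, v⟫ * ⟪x, w⟫ + ⟪x, mulI n v⟫ * ⟪x, mulI n w⟫) := by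
  have hyx : ⟪y, mulI n x⟫ = 0 := by
    rw [real_inner_comm, inner_mulI_left, hxy, neg_zero]
  rw [conj_rankTwo_apply, rankTwo_apply]
  simp only [inner_add_left, inner_sub_left, inner_add_right, inner_sub_right,
    real_inner_smul_left, real_inner_smul_right, inner_mulI_left, hxy, hyx, inner_self_mulI,
    real_inner_comm v y, real_inner_comm v x]
  rw [real_inner_comm y v, real_inner_comm x v]
  ring

/-- Split w into its component along the complex line of x and the orthogonal component u. Since
V|x|² ≤ 1, the form 1 - V Π_x is nonnegative and can vanish only on that line; there, if V|x|² = 1,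
the term in U is positive because ⟨y, x⟩ > 0. -/
lemma rankTwo_pos (h : PositivePair U V x y) {w : Cn n} (hw : w ≠ 0) :
    0 < ⟪-mulI n (rankTwo U V x y (mulI n w)), rankTwo U V x y w⟫ := by
  obtain ⟨hxy, hy, hU, hV, hUV⟩ := h
  rw [inner_conj_rankTwo hxy]
  have hx : x ≠ 0 := by rintro rfl; simp at hy
  have hxx : 0 < ⟪x, x⟫ := real_inner_self_pos.2 hx
  set α := ⟪x, w⟫ / ⟪x, x⟫ with hα
  set β := ⟪x, mulI n w⟫ / ⟪x, x⟫ with hβ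
  have hα' : ⟪x, w⟫ = α * ⟪x, x⟫ := by rw [hα]; field_simp
  have hβ' : ⟪x, mulI n w⟫ = β * ⟪x, x⟫ := by rw [hβ]; field_simp
  set u := w - α • x + β • mulI n x with hu
  have hwu : w = u + α • x - β • mulI n x := by rw [hu]; abel
  have h1 : ⟪w, w⟫ = ⟪u, u⟫ + (α ^ 2 + β ^ 2) * ⟪x, x⟫ := by
    have e1 : ⟪w, x⟫ = α * ⟪x, x⟫ := by rw [real_inner_comm]; exact hα'
    have e2 : ⟪w, mulI n x⟫ = -(β * ⟪x, x⟫) := by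
      rw [real_inner_comm, inner_mulI_left, hβ']
    rw [hu]
    simp only [inner_add_left, inner_sub_left, inner_add_right, inner_sub_right,
      real_inner_smul_left, real_inner_smul_right, hα', e1, e2, inner_self_mulI, inner_mulI_left,
      mulI_mulI, inner_neg_right, hβ']
    ring
  have huu : 0 ≤ ⟪u, u⟫ := real_inner_self_nonneg
  have hrew : ⟪w, w⟫ + U * (⟪y, w⟫ * ⟪y, w⟫ + ⟪y, mulI n w⟫ * ⟪y, mulI n w⟫)
      - V * (⟪x, w⟫ * ⟪x, w⟫ + ⟪x, mulI n w⟫ * ⟪x, mulI n w⟫) =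
      ⟪u, u⟫ + (α ^ 2 + β ^ 2) * ⟪x, x⟫ * (1 - V * ⟪x, x⟫)
        + U * (⟪y, w⟫ ^ 2 + ⟪y, mulI n w⟫ ^ 2) := by
    rw [h1, hα', hβ']; ring
  rw [hrew]
  have t2 : 0 ≤ (α ^ 2 + β ^ 2) * ⟪x, x⟫ * (1 - V * ⟪x, x⟫) :=
    mul_nonneg (by positivity) (by linarith)
  have t3 : 0 ≤ U * (⟪y, w⟫ ^ 2 + ⟪y, mulI n w⟫ ^ 2) := by positivity
  by_cases hu0 : u = 0
  · have hαβ : 0 < α ^ 2 + β ^ 2 := by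
      by_contra hcon
      have ha0 : α = 0 := by nlinarith [sq_nonneg α, sq_nonneg β]
      have hb0 : β = 0 := by nlinarith [sq_nonneg α, sq_nonneg β]
      apply hw
      rw [hwu, hu0, ha0, hb0]; simp
    rcases hUV with hlt | hpos
    · have : 0 < (α ^ 2 + β ^ 2) * ⟪x, x⟫ * (1 - V * ⟪x, x⟫) :=
        mul_pos (by positivity) (by linarith)
      linarith
    · have hyx : ⟪y, mulI n x⟫ = 0 := by
        rw [real_inner_comm, inner_mulI_left, hxy, neg_zero]
      have e1 : ⟪y, w⟫ = α * ⟪y, x⟫ := by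
        rw [hwu, hu0]
        simp [inner_sub_right, real_inner_smul_right, hyx]
      have e2 : ⟪y, mulI n w⟫ = β * ⟪y, x⟫ := by
        rw [hwu, hu0]
        simp [inner_add_right, real_inner_smul_right, hyx, mulI_mulI]
      have : 0 < U * (⟪y, w⟫ ^ 2 + ⟪y, mulI n w⟫ ^ 2) := by
        rw [e1, e2, mul_pow, mul_pow, ← add_mul]; positivity
      linarith
  · have := real_inner_self_pos.2 hu0
    linarith

/-- The commutation of N with -i N i. It shows that N⁻¹ i N sends -i N i w to i N w, which avoids
inverting N. -/
lemma rankTwo_mulI_comm (hxy : ⟪x, mulI n y⟫ = 0) (w : Cn n) :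
    rankTwo U V x y (mulI n (rankTwo U V x y w)) =
      mulI n (rankTwo U V x y (-mulI n (rankTwo U V x y (mulI n w)))) := by
  have hyx : ⟪y, mulI n x⟫ = 0 := by
    rw [real_inner_comm, inner_mulI_left, hxy, neg_zero]
  rw [conj_rankTwo_apply]
  simp only [rankTwo_apply, map_add, map_sub, map_smul, hxy, hyx, inner_self_mulI, mulI_mulI]
  module

lemma rankTwo_injective (h : PositivePair U V x y) : Function.Injective (rankTwo U V x y) := by
  rw [injective_iff_map_eq_zero]
  intro w hw
  by_contra hne
  have := rankTwo_pos h hne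
  rw [hw, inner_zero_right] at this
  exact this.false

lemma exists_conj_rankTwo_eq (h : PositivePair U V x y) (v : Cn n) :
    ∃ w, -mulI n (rankTwo U V x y (mulI n w)) = v := by
  let T : Cn n →ₗ[ℝ] Cn n :=
    (-(mulI n ∘L rankTwo U V x y ∘L mulI n) : Cn n →L[ℝ] Cn n).toLinearMap
  have hT : Function.Injective T := by
    rw [injective_iff_map_eq_zero]
    intro w hw
    by_contra hne
    have := rankTwo_pos h hne
    rw [show -mulI n (rankTwo U V x y (mulI n w)) = 0 from hw, inner_zero_left] at this
    exact this.false
  exact LinearMap.injective_iff_surjective.1 hT v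

/-- If `A = D N` with `D` complex linear and injective, then `A⁻¹ i A` is tamed by the standard
symplectic form. -/
lemma rankTwo_tame (h : PositivePair U V x y) {D : Cn n →L[ℝ] Cn n}
    (hD : Function.Injective D) (hDI : ∀ v, mulI n (D v) = D (mulI n v)) {v v' : Cn n}
    (hv : D (rankTwo U V x y v') = mulI n (D (rankTwo U V x y v))) (hv0 : v ≠ 0) :
    0 < stdForm n ![v, v'] := by
  obtain ⟨w, rfl⟩ := exists_conj_rankTwo_eq h v
  rw [hDI, ← rankTwo_mulI_comm h.orthogonal] at hv
  rw [rankTwo_injective h (hD hv), stdForm_apply, inner_mulI_mulI]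
  refine rankTwo_pos h ?_
  rintro rfl
  simp at hv0

/-- With N' = -i N i, v = N' v₀ and w = N' w₀, commutation gives v' = i N v₀ and w' = i N w₀. The
claim becomes ω(N v₀, N w₀) = ω(N' v₀, N' w₀), that is N i N = N' i N' by symmetry of both
operators, which is commutation again. -/
lemma rankTwo_compatible (h : PositivePair U V x y) {D : Cn n →L[ℝ] Cn n}
    (hD : Function.Injective D) (hDI : ∀ v, mulI n (D v) = D (mulI n v)) {v v' w w' : Cn n}
    (hv : D (rankTwo U V x y v') = mulI n (D (rankTwo U V x y v)))
    (hw : D (rankTwo U V x y w') = mulI n (D (rankTwo U V x y w))) :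
    stdForm n ![v', w'] = stdForm n ![v, w] := by
  obtain ⟨v₀, rfl⟩ := exists_conj_rankTwo_eq h v
  obtain ⟨w₀, rfl⟩ := exists_conj_rankTwo_eq h w
  rw [hDI, ← rankTwo_mulI_comm h.orthogonal] at hv hw
  rw [rankTwo_injective h (hD hv), rankTwo_injective h (hD hw)]
  have hyx : ⟪y, mulI n x⟫ = 0 := by
    rw [real_inner_comm, inner_mulI_left, h.orthogonal, neg_zero]
  rw [stdForm_apply, stdForm_apply, conj_rankTwo_apply, conj_rankTwo_apply, rankTwo_apply,
    rankTwo_apply]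
  simp only [map_add, map_sub, map_smul, mulI_mulI, inner_add_left, inner_sub_left,
    inner_add_right, inner_sub_right, inner_neg_left, inner_neg_right, real_inner_smul_left,
    real_inner_smul_right, inner_mulI_left, h.orthogonal, hyx, inner_self_mulI,
    real_inner_comm v₀ y, real_inner_comm v₀ x]
  rw [real_inner_comm y v₀, real_inner_comm x v₀]
  have e1 : ⟪v₀, mulI n y⟫ = -⟪y, mulI n v₀⟫ := by rw [real_inner_comm, inner_mulI_left]
  have e2 : ⟪v₀, mulI n x⟫ = -⟪x, mulI n v₀⟫ := by rw [real_inner_comm, inner_mulI_left]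
  rw [e1, e2]
  ring

end

end Linear

/-! ### The stretching map: derivative, compatibility, injectivity -/

section Stretch

variable {n : ℕ}

/-- The frequencies `2π / a_j` of the Reeb flow on `∂E(a)`. -/
def freq (a : Fin n → ℝ) (j : Fin n) : ℝ := 2 * Real.pi / a j

lemma freq_pos {a : Fin n → ℝ} (ha : ∀ i, 0 < a i) (j : Fin n) : 0 < freq a j :=
  div_pos Real.two_pi_pos (ha j)

lemma H_eq_sum (a : Fin n → ℝ) (z : Cn n) : H a z = (1 / 2) * ∑ j, freq a j * ‖z j‖ ^ 2 := by
  rw [H, Finset.mul_sum, Finset.mul_sum]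
  exact Finset.sum_congr rfl fun j _ => by rw [freq]; ring

lemma H_eq_inner (a : Fin n → ℝ) (z : Cn n) : H a z = (1 / 2) * ⟪scale (freq a) z, z⟫ := by
  rw [H_eq_sum, inner_eq_sum]
  congr 1
  refine Finset.sum_congr rfl fun j _ => ?_
  rw [← Complex.normSq_eq_norm_sq, Complex.normSq_apply, scale_apply]
  simp
  ring

lemma hasFDerivAt_H (a : Fin n → ℝ) (z : Cn n) :
    HasFDerivAt (H a) (innerSL ℝ (scale (freq a) z)) z := by
  have h := ((scale (freq a)).hasFDerivAt (x := z)).inner ℝ (hasFDerivAt_id z)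
  have h2 := h.const_mul (1 / 2 : ℝ)
  rw [show H a = fun z => (1 / 2 : ℝ) * ⟪scale (freq a) z, id z⟫ from
    funext fun z => H_eq_inner a z]
  refine h2.congr_fderiv ?_
  ext v
  simp only [_root_.smul_apply, ContinuousLinearMap.comp_apply,
    ContinuousLinearMap.prod_apply, fderivInnerCLM_apply, ContinuousLinearMap.id_apply,
    innerSL_apply_apply, smul_eq_mul, id]
  rw [inner_scale_left (freq a) v z, real_inner_comm v]
  ring

lemma mem_bdryTangent {a : Fin n → ℝ} {z v : Cn n} :
    v ∈ bdryTangent a z ↔ ⟪scale (freq a) z, v⟫ = 0 := by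
  rw [bdryTangent, (hasFDerivAt_H a z).fderiv, LinearMap.mem_ker]
  rfl

lemma contDiff_H (a : Fin n → ℝ) : ContDiff ℝ ∞ (H a) := by
  rw [show H a = fun z => (1 / 2 : ℝ) * ⟪scale (freq a) z, z⟫ from funext (H_eq_inner a)]
  exact contDiff_const.mul ((scale (freq a)).contDiff.inner ℝ contDiff_id)

/-- The factors `e^{2π/a_j p(log H) - q(log |x|)}`. -/
def stretchFactor (a : Fin n → ℝ) (p q : ℝ → ℝ) (x : Cn n) (j : Fin n) : ℝ :=
  Real.exp (freq a j * p (Real.log (H a x)) - q (Real.log ‖x‖))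

/-- The map `x_j ↦ e^{2π/a_j p(log H) - q(log |x|)} x_j`. -/
def stretch (a : Fin n → ℝ) (p q : ℝ → ℝ) (x : Cn n) : Cn n :=
  scale (stretchFactor a p q x) x

/-- Conditions on `p` and `q` under which `stretch a p q` pulls the standard complex structure
back to one compatible with the standard symplectic form. -/
structure IsProfile (a : Fin n → ℝ) (p q : ℝ → ℝ) : Prop where
  contDiff_left : ContDiff ℝ ∞ p
  contDiff_right : ContDiff ℝ ∞ q
  deriv_nonneg : ∀ t, 0 ≤ deriv p t
  deriv_le_one : ∀ t, deriv q t ≤ 1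
  strict : ∀ x : Cn n, x ≠ 0 → deriv q (Real.log ‖x‖) < 1 ∨ 0 < deriv p (Real.log (H a x))

/-- The derivative of `stretch a p q` up to a diagonal factor. -/
def stretchDeriv (a : Fin n → ℝ) (p q : ℝ → ℝ) (x : Cn n) : Cn n →L[ℝ] Cn n :=
  rankTwo (deriv p (Real.log (H a x)) / H a x) (deriv q (Real.log ‖x‖) / ‖x‖ ^ 2) x
    (scale (freq a) x)

variable {a : Fin n → ℝ} {p q : ℝ → ℝ}

lemma stretchFactor_pos (x : Cn n) (j : Fin n) : 0 < stretchFactor a p q x j := Real.exp_pos _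

lemma stretch_apply (x : Cn n) (j : Fin n) :
    stretch a p q x j = stretchFactor a p q x j • x j := rfl

lemma stretch_zero : stretch a p q (0 : Cn n) = 0 := by
  rw [stretch, map_zero]

lemma stretch_eq_zero_iff {x : Cn n} : stretch a p q x = 0 ↔ x = 0 := by
  refine ⟨fun h => ?_, fun h => by rw [h, stretch_zero]⟩
  exact scale_injective (fun j => (stretchFactor_pos x j).ne') (by rw [map_zero]; exact h)

lemma stretch_eq_self {x : Cn n} (hp : p (Real.log (H a x)) = 0) (hq : q (Real.log ‖x‖) = 0) :
    stretch a p q x = x := by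
  ext j
  simp [stretch_apply, stretchFactor, hp, hq]

/-- Here V|x|² = q' and U H = p', and ⟨y, x⟩ = 2H > 0, so the conditions on the profile are exactly
those on the pair. -/
lemma IsProfile.positivePair (h : IsProfile a p q) (ha : ∀ i, 0 < a i) {x : Cn n} (hx : x ≠ 0) :
    PositivePair (deriv p (Real.log (H a x)) / H a x) (deriv q (Real.log ‖x‖) / ‖x‖ ^ 2) x
      (scale (freq a) x) where
  orthogonal := inner_mulI_scale _ _
  inner_pos := by
    have := H_pos ha hx
    rw [H_eq_inner] at this
    linarith
  nonneg := div_nonneg (h.deriv_nonneg _) (H_pos ha hx).le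
  le_one := by
    rw [real_inner_self_eq_norm_sq, div_mul_cancel₀ _ (by positivity)]
    exact h.deriv_le_one _
  strict := by
    rw [real_inner_self_eq_norm_sq, div_mul_cancel₀ _ (by positivity)]
    exact (h.strict x hx).imp_right fun h => div_pos h (H_pos ha hx)

lemma hasFDerivAt_stretch (h : IsProfile a p q) (ha : ∀ i, 0 < a i) {x : Cn n} (hx : x ≠ 0) :
    HasFDerivAt (stretch a p q)
      (scale (stretchFactor a p q x) ∘L stretchDeriv a p q x) x := by
  have hH := (hasFDerivAt_H a x).log (H_pos ha hx).ne'
  have hn : HasFDerivAt (fun x : Cn n => Real.log ‖x‖) ((‖x‖ ^ 2)⁻¹ • innerSL ℝ x) x := by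
    have h1 := ((hasStrictFDerivAt_norm_sq x).hasFDerivAt.log (by positivity)).const_mul
      (1 / 2 : ℝ)
    refine (h1.congr_fderiv ?_).congr_of_eventuallyEq (Eventually.of_forall fun y => ?_)
    · ext v; simp; ring
    · simp only [Real.log_pow]; push_cast; ring
  have hp := (((h.contDiff_left.differentiable (by simp)) _).hasDerivAt).comp_hasFDerivAt x hH
  have hq := (((h.contDiff_right.differentiable (by simp)) _).hasDerivAt).comp_hasFDerivAt x hn
  rw [← hasFDerivWithinAt_univ, hasFDerivWithinAt_piLp]
  intro j
  have hj : HasFDerivAt (fun y : Cn n => y j) (PiLp.proj (𝕜 := ℝ) 2 (fun _ : Fin n => ℂ) j) x :=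
    (PiLp.proj (𝕜 := ℝ) 2 (fun _ : Fin n => ℂ) j).hasFDerivAt
  have hf := ((hp.const_mul (freq a j)).sub hq).exp.smul hj
  refine (hf.congr_fderiv ?_).hasFDerivWithinAt
  ext v
  simp [stretchDeriv, rankTwo_apply, scale_apply, stretchFactor]
  ring

lemma contDiffAt_stretch (h : IsProfile a p q) (ha : ∀ i, 0 < a i) {x : Cn n} (hx : x ≠ 0) :
    ContDiffAt ℝ ∞ (stretch a p q) x := by
  rw [contDiffAt_piLp]
  intro j
  have hp := h.contDiff_left.contDiffAt.comp x
    ((contDiff_H a).contDiffAt.log (H_pos ha hx).ne')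
  have hq := h.contDiff_right.contDiffAt.comp x
    ((contDiffAt_norm ℝ hx).log (norm_ne_zero_iff.2 hx))
  have hj : ContDiffAt ℝ ∞ (fun y : Cn n => y j) x :=
    (PiLp.proj (𝕜 := ℝ) 2 (fun _ : Fin n => ℂ) j).contDiff.contDiffAt
  exact ((contDiffAt_const.mul hp).sub hq).exp.smul hj

lemma isInvertible_of_injective {T : Cn n →L[ℝ] Cn n} (hT : Function.Injective T) :
    T.IsInvertible :=
  ⟨(LinearEquiv.ofInjectiveEndo T.toLinearMap hT).toContinuousLinearEquiv, by ext; rfl⟩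

lemma stretch_fderiv_injective (h : IsProfile a p q) (ha : ∀ i, 0 < a i) {x : Cn n}
    (hx : x ≠ 0) :
    Function.Injective (scale (stretchFactor a p q x) ∘L stretchDeriv a p q x) :=
  (scale_injective fun j => (stretchFactor_pos x j).ne').comp
    (rankTwo_injective (h.positivePair ha hx))

/-- The variation of `∑ d_j log |φ_j|` along a segment in the variables `|x_j|²` is positive. -/
lemma IsProfile.segment_pos (h : IsProfile a p q) (ha : ∀ i, 0 < a i) {m d : Fin n → ℝ}
    (hm : ∀ j, 0 ≤ m j) (hmd : ∀ j, m j = 0 → d j = 0) (hd : d ≠ 0) :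
    0 < ∑ j, d j * (d j / m j)
      + deriv p (Real.log (1 / 2 * ∑ j, freq a j * m j)) / (1 / 2 * ∑ j, freq a j * m j)
        * (∑ j, freq a j * d j) ^ 2
      - deriv q (1 / 2 * Real.log (∑ j, m j)) / (∑ j, m j) * (∑ j, d j) ^ 2 := by
  -- With x_j = √m_j and w_j = d_j/√m_j the products ⟨x, w⟩, ⟨y, w⟩, ⟨w, w⟩ become the three sums of
  -- the claim, and the products with i w vanish because all entries are real. Division by zero is
  -- harmless: d_j = 0 whenever m_j = 0.
  let x : Cn n := WithLp.toLp 2 fun j => ((Real.sqrt (m j) : ℝ) : ℂ)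
  let w : Cn n := WithLp.toLp 2 fun j => ((d j / Real.sqrt (m j) : ℝ) : ℂ)
  obtain ⟨i, hi⟩ := Function.ne_iff.1 hd
  have hmi : 0 < m i := (hm i).lt_of_ne fun h0 => hi (hmd i h0.symm)
  have hx : x ≠ 0 := by
    intro h0
    have := congrArg (fun y : Cn n => y i) h0
    simp [x, Real.sqrt_eq_zero'] at this
    linarith
  have hw : w ≠ 0 := by
    intro h0
    have := congrArg (fun y : Cn n => y i) h0
    simp only [w, PiLp.zero_apply, Complex.ofReal_eq_zero, div_eq_zero_iff] at this
    rcases this with h1 | h1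
    · exact hi h1
    · rw [Real.sqrt_eq_zero'] at h1; linarith
  have hxj : ∀ j, ‖x j‖ ^ 2 = m j := fun j => by simp [x, Real.sq_sqrt (hm j)]
  have hpos := rankTwo_pos (h.positivePair ha hx) hw
  rw [inner_conj_rankTwo (inner_mulI_scale _ _)] at hpos
  have hmul : ∀ j, Real.sqrt (m j) * (d j / Real.sqrt (m j)) = d j := fun j => by
    rcases (hm j).eq_or_lt with h0 | h0
    · simp [hmd j h0.symm]
    · have := Real.sqrt_pos.2 h0; field_simp
  have e1 : ⟪w, w⟫ = ∑ j, d j * (d j / m j) := by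
    rw [inner_eq_sum]
    refine Finset.sum_congr rfl fun j _ => ?_
    simp only [w, Complex.ofReal_re, Complex.ofReal_im]
    rw [div_mul_div_comm, Real.mul_self_sqrt (hm j)]
    ring
  have e2 : ⟪x, w⟫ = ∑ j, d j := by
    rw [inner_eq_sum]
    exact Finset.sum_congr rfl fun j _ => by
      simp only [x, w, Complex.ofReal_re, Complex.ofReal_im, hmul]; ring
  have e3 : ⟪scale (freq a) x, w⟫ = ∑ j, freq a j * d j := by
    rw [inner_eq_sum]
    refine Finset.sum_congr rfl fun j _ => ?_
    rw [scale_apply, ← hmul j]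
    simp [x, w]
    ring
  have e4 : ⟪x, mulI n w⟫ = 0 := by
    rw [inner_eq_sum]
    exact Finset.sum_eq_zero fun j _ => by simp [x, w, mulI_apply_apply]
  have e5 : ⟪scale (freq a) x, mulI n w⟫ = 0 := by
    rw [inner_eq_sum]
    exact Finset.sum_eq_zero fun j _ => by simp [x, w, mulI_apply_apply, scale_apply]
  have eH : H a x = 1 / 2 * ∑ j, freq a j * m j := by
    rw [H_eq_sum]
    simp only [hxj]
  have en : ‖x‖ ^ 2 = ∑ j, m j := by
    rw [EuclideanSpace.norm_sq_eq]
    simp only [hxj]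
  have el : Real.log ‖x‖ = 1 / 2 * Real.log (∑ j, m j) := by
    rw [← en, Real.log_pow]; push_cast; ring
  rw [e1, e2, e3, e4, e5, eH, en, el] at hpos
  rw [sq (∑ j, freq a j * d j), sq (∑ j, d j)]
  linarith

/-- The factors are positive, so two points with the same image have the same arguments
coordinatewise and it suffices to compare moduli. If the moduli differ, pair the change d of the
|x_j|² with log |φ_j| along the segment between them, φ being the map. This function has positive
derivative by `IsProfile.segment_pos` but equal values at the ends, against Rolle's theorem. -/
lemma stretch_injective (h : IsProfile a p q) (ha : ∀ i, 0 < a i) :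
    Function.Injective (stretch a p q) := by
  intro x y hxy
  have hj : ∀ j, stretchFactor a p q x j • x j = stretchFactor a p q y j • y j := fun j =>
    congrArg (fun z : Cn n => z j) hxy
  have hnorm : ∀ j, stretchFactor a p q x j * ‖x j‖ = stretchFactor a p q y j * ‖y j‖ := by
    intro j
    have := congrArg norm (hj j)
    rwa [norm_smul, norm_smul, Real.norm_of_nonneg (stretchFactor_pos x j).le,
      Real.norm_of_nonneg (stretchFactor_pos y j).le] at this
  have hzero : ∀ j, ‖x j‖ = 0 ↔ ‖y j‖ = 0 := by
    intro j
    have h1 := (stretchFactor_pos (a := a) (p := p) (q := q) x j).ne'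
    have h2 := (stretchFactor_pos (a := a) (p := p) (q := q) y j).ne'
    have := hnorm j
    constructor <;> intro h0
    · rw [h0, mul_zero] at this
      exact (mul_eq_zero.1 this.symm).resolve_left h2
    · rw [h0, mul_zero] at this
      exact (mul_eq_zero.1 this).resolve_left h1
  by_cases hd : (fun j => ‖y j‖ ^ 2 - ‖x j‖ ^ 2) = 0
  · ext j
    have h1 : ‖y j‖ = ‖x j‖ := by
      have := congrFun hd j
      simp only [Pi.zero_apply, sub_eq_zero] at this
      exact (pow_left_inj₀ (norm_nonneg _) (norm_nonneg _) two_ne_zero).1 this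
    by_cases h0 : ‖x j‖ = 0
    · rw [norm_eq_zero.1 h0, norm_eq_zero.1 ((hzero j).1 h0)]
    · have h2 := hnorm j
      rw [h1] at h2
      have h3 := mul_right_cancel₀ h0 h2
      have h4 := hj j
      rw [h3] at h4
      exact smul_right_injective ℂ (stretchFactor_pos y j).ne' h4
  · exfalso
    set d : Fin n → ℝ := fun j => ‖y j‖ ^ 2 - ‖x j‖ ^ 2 with hdd
    let m : ℝ → Fin n → ℝ := fun t j => ‖x j‖ ^ 2 + t * d j
    have hd0 : ∀ j, ‖x j‖ = 0 → d j = 0 := fun j h0 => by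
      simp [d, h0, (hzero j).1 h0]
    have hm : ∀ t ∈ Icc (0 : ℝ) 1, ∀ j, ‖x j‖ ≠ 0 → 0 < m t j := by
      intro t ht j h0
      have h1 : 0 < ‖x j‖ ^ 2 := by positivity
      have h2 : 0 < ‖y j‖ ^ 2 := by
        have : ‖y j‖ ≠ 0 := fun h => h0 ((hzero j).2 h)
        positivity
      have : m t j = (1 - t) * ‖x j‖ ^ 2 + t * ‖y j‖ ^ 2 := by simp only [m, d]; ring
      rw [this]
      rcases ht.1.eq_or_lt with rfl | h3
      · simpa using h1
      · have := mul_nonneg (sub_nonneg.2 ht.2) h1.le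
        have := mul_pos h3 h2
        linarith
    have hm0 : ∀ t ∈ Icc (0 : ℝ) 1, ∀ j, 0 ≤ m t j := by
      intro t ht j
      by_cases h0 : ‖x j‖ = 0
      · simp [m, h0, hd0 j h0]
      · exact (hm t ht j h0).le
    obtain ⟨i, hi⟩ := Function.ne_iff.1 hd
    have hxi : ‖x i‖ ≠ 0 := fun h0 => hi (hd0 i h0)
    have hs : ∀ t ∈ Icc (0 : ℝ) 1, 0 < ∑ j, m t j := fun t ht =>
      Finset.sum_pos' (fun j _ => hm0 t ht j) ⟨i, Finset.mem_univ _, hm t ht i hxi⟩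
    have hh : ∀ t ∈ Icc (0 : ℝ) 1, 0 < 1 / 2 * ∑ j, freq a j * m t j := fun t ht =>
      mul_pos (by norm_num) (Finset.sum_pos'
        (fun j _ => mul_nonneg (freq_pos ha j).le (hm0 t ht j))
        ⟨i, Finset.mem_univ _, mul_pos (freq_pos ha i) (hm t ht i hxi)⟩)
    -- This is Σ d_j log |φ_j|, written in terms of the squared moduli m_j(t). Coordinates that
    -- vanish at both ends have d_j = 0 and drop out, so the logarithm is never differentiated at 0.
    let g : ℝ → ℝ := fun t => ∑ j, d j * (1 / 2 * Real.log (m t j)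
      + (freq a j * p (Real.log (1 / 2 * ∑ j, freq a j * m t j))
        - q (1 / 2 * Real.log (∑ j, m t j))))
    have hg : ∀ t ∈ Icc (0 : ℝ) 1, HasDerivAt g (∑ j, d j * (1 / 2 * (d j / m t j)
        + (freq a j * (deriv p (Real.log (1 / 2 * ∑ j, freq a j * m t j))
            * ((1 / 2 * ∑ j, freq a j * d j) / (1 / 2 * ∑ j, freq a j * m t j)))
          - deriv q (1 / 2 * Real.log (∑ j, m t j))
            * (1 / 2 * ((∑ j, d j) / ∑ j, m t j))))) t := by
      intro t ht
      have dm : ∀ j, HasDerivAt (fun t => m t j) (d j) t := fun j => by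
        simpa [m] using ((hasDerivAt_id t).mul_const (d j)).const_add (‖x j‖ ^ 2)
      have dh := ((HasDerivAt.fun_sum fun j (_ : j ∈ Finset.univ) =>
        (dm j).const_mul (freq a j)).const_mul (1 / 2 : ℝ)).log (hh t ht).ne'
      have ds := ((HasDerivAt.fun_sum fun j (_ : j ∈ Finset.univ) => dm j).log
        (hs t ht).ne').const_mul (1 / 2 : ℝ)
      have dp := ((h.contDiff_left.differentiable (by simp)) _).hasDerivAt.comp t dh
      have dq := ((h.contDiff_right.differentiable (by simp)) _).hasDerivAt.comp t ds
      refine HasDerivAt.fun_sum fun j _ => ?_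
      by_cases h0 : ‖x j‖ = 0
      · simp only [hd0 j h0, zero_mul]
        exact hasDerivAt_const _ _
      · exact (((dm j).log (hm t ht j h0).ne').const_mul (1 / 2 : ℝ)
          |>.add ((dp.const_mul (freq a j)).sub dq)).const_mul (d j)
    have hmx : ∀ j, m 0 j = ‖x j‖ ^ 2 := fun j => by simp [m]
    have hmy : ∀ j, m 1 j = ‖y j‖ ^ 2 := fun j => by simp [m, d]
    have hlog : ∀ z : Cn n, 1 / 2 * Real.log (∑ j, ‖z j‖ ^ 2) = Real.log ‖z‖ := fun z => by
      rw [← EuclideanSpace.norm_sq_eq, Real.log_pow]; push_cast; ring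
    have hlogF : ∀ z : Cn n, ∀ j, freq a j * p (Real.log (H a z)) - q (Real.log ‖z‖)
        = Real.log (stretchFactor a p q z j) := fun z j => (Real.log_exp _).symm
    have hend : g 0 = g 1 := by
      simp only [g, hmx, hmy, hlog, ← H_eq_sum, hlogF, Real.log_pow]
      refine Finset.sum_congr rfl fun j _ => ?_
      by_cases h0 : ‖x j‖ = 0
      · simp [hd0 j h0]
      · have h1 : ‖y j‖ ≠ 0 := fun h => h0 ((hzero j).2 h)
        have := congrArg Real.log (hnorm j)
        rw [Real.log_mul (stretchFactor_pos x j).ne' h0,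
          Real.log_mul (stretchFactor_pos y j).ne' h1] at this
        push_cast
        congr 1
        linarith
    obtain ⟨c, hc, hc0⟩ := exists_hasDerivAt_eq_zero zero_lt_one
      (fun t ht => (hg t ht).continuousAt.continuousWithinAt) hend
      (fun t ht => hg t (Ioo_subset_Icc_self ht))
    have hcI := Ioo_subset_Icc_self hc
    have hpos := h.segment_pos ha (hm0 c hcI) (d := d) (fun j hj => by
      by_contra hne
      exact (hm c hcI j fun h0 => hne (hd0 j h0)).ne' hj) hd
    have hsplit : ∀ A B : ℝ, ∑ j, d j * (1 / 2 * (d j / m c j) + (freq a j * A - B)) =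
        1 / 2 * ∑ j, d j * (d j / m c j) + (∑ j, freq a j * d j) * A - (∑ j, d j) * B := by
      intro A B
      rw [Finset.mul_sum, Finset.sum_mul, Finset.sum_mul, ← Finset.sum_add_distrib,
        ← Finset.sum_sub_distrib]
      exact Finset.sum_congr rfl fun j _ => by ring
    rw [hsplit] at hc0
    have hh' := hh c hcI
    have hs' := hs c hcI
    have e1 : (∑ j, freq a j * d j) * (deriv p (Real.log (1 / 2 * ∑ j, freq a j * m c j))
            * ((1 / 2 * ∑ j, freq a j * d j) / (1 / 2 * ∑ j, freq a j * m c j)))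
        = 1 / 2 * (deriv p (Real.log (1 / 2 * ∑ j, freq a j * m c j))
          / (1 / 2 * ∑ j, freq a j * m c j) * (∑ j, freq a j * d j) ^ 2) := by ring
    have e2 : (∑ j, d j) * (deriv q (1 / 2 * Real.log (∑ j, m c j))
            * (1 / 2 * ((∑ j, d j) / ∑ j, m c j)))
        = 1 / 2 * (deriv q (1 / 2 * Real.log (∑ j, m c j)) / (∑ j, m c j)
          * (∑ j, d j) ^ 2) := by ring
    rw [e1, e2] at hc0
    linarith

end Stretch

/-! ### Cutoff functions for the profiles -/

section Profiles

/-- A smooth monotone function vanishing for `t ≤ 0` and equal to `t` for `t ≥ 1`. -/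
def ramp (t : ℝ) : ℝ := t * Real.smoothTransition t

/-- A smooth function with derivative at most `1`, vanishing for `t ≤ -1` and equal to `t` for
`t ≥ 0`. -/
def steepRamp (t : ℝ) : ℝ := t * Real.smoothTransition (1 + t)

lemma contDiff_ramp : ContDiff ℝ ∞ ramp :=
  contDiff_id.mul Real.smoothTransition.contDiff

lemma contDiff_steepRamp : ContDiff ℝ ∞ steepRamp :=
  contDiff_id.mul (Real.smoothTransition.contDiff.comp (contDiff_const.add contDiff_id))

lemma ramp_of_nonpos {t : ℝ} (ht : t ≤ 0) : ramp t = 0 := by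
  rw [ramp, Real.smoothTransition.zero_of_nonpos ht, mul_zero]

lemma ramp_of_one_le {t : ℝ} (ht : 1 ≤ t) : ramp t = t := by
  rw [ramp, Real.smoothTransition.one_of_one_le ht, mul_one]

lemma steepRamp_of_le {t : ℝ} (ht : t ≤ -1) : steepRamp t = 0 := by
  rw [steepRamp, Real.smoothTransition.zero_of_nonpos (by linarith), mul_zero]

lemma steepRamp_of_nonneg {t : ℝ} (ht : 0 ≤ t) : steepRamp t = t := by
  rw [steepRamp, Real.smoothTransition.one_of_one_le (by linarith), mul_one]

lemma monotone_ramp : Monotone ramp := by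
  intro s t hst
  rcases le_total s 0 with hs | hs
  · rw [ramp_of_nonpos hs]
    rcases le_total t 0 with ht | ht
    · rw [ramp_of_nonpos ht]
    · exact mul_nonneg ht (Real.smoothTransition.nonneg _)
  · exact mul_le_mul hst (Real.smoothTransition.monotone hst) (Real.smoothTransition.nonneg _)
      (hs.trans hst)

/-- For t ≤ 0 the function is minus the product of the two nonnegative decreasing functions -t and 1
- s(1 + t), where s is the smooth transition; for t ≥ 0 it vanishes. -/
lemma monotone_sub_steepRamp : Monotone fun t => t - steepRamp t := by
  intro s t hst
  simp only
  rcases le_total 0 t with ht | ht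
  · rw [steepRamp_of_nonneg ht, sub_self]
    rcases le_total 0 s with hs | hs
    · rw [steepRamp_of_nonneg hs, sub_self]
    · have := Real.smoothTransition.le_one (1 + s)
      simp only [steepRamp]
      nlinarith
  · have h1 := Real.smoothTransition.le_one (1 + t)
    have h2 : Real.smoothTransition (1 + s) ≤ Real.smoothTransition (1 + t) :=
      Real.smoothTransition.monotone (by linarith)
    simp only [steepRamp]
    nlinarith [mul_nonneg (sub_nonneg.2 hst) (sub_nonneg.2 h1),
      mul_nonneg (neg_nonneg.2 (hst.trans ht)) (sub_nonneg.2 h2)]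

lemma deriv_ramp_nonneg (t : ℝ) : 0 ≤ deriv ramp t := monotone_ramp.deriv_nonneg

lemma deriv_steepRamp_le_one (t : ℝ) : deriv steepRamp t ≤ 1 := by
  have h : 0 ≤ deriv (fun t => t - steepRamp t) t := monotone_sub_steepRamp.deriv_nonneg
  rw [deriv_fun_sub differentiableAt_fun_id (contDiff_steepRamp.differentiable (by simp) t),
    deriv_id''] at h
  linarith

lemma deriv_ramp_of_one_lt {t : ℝ} (ht : 1 < t) : deriv ramp t = 1 := by
  have h : ramp =ᶠ[𝓝 t] fun t => t := by
    filter_upwards [lt_mem_nhds ht] with s hs using ramp_of_one_le (le_of_lt hs)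
  rw [h.deriv_eq, deriv_id'']

lemma deriv_steepRamp_of_pos {t : ℝ} (ht : 0 < t) : deriv steepRamp t = 1 := by
  have h : steepRamp =ᶠ[𝓝 t] fun t => t := by
    filter_upwards [lt_mem_nhds ht] with s hs using steepRamp_of_nonneg (le_of_lt hs)
  rw [h.deriv_eq, deriv_id'']

lemma deriv_steepRamp_of_lt {t : ℝ} (ht : t < -1) : deriv steepRamp t = 0 := by
  have h : steepRamp =ᶠ[𝓝 t] fun _ => 0 := by
    filter_upwards [gt_mem_nhds ht] with s hs using steepRamp_of_le (le_of_lt hs)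
  rw [h.deriv_eq, deriv_const]

lemma deriv_neg_comp_sub (f : ℝ → ℝ) (hf : Differentiable ℝ f) (k t : ℝ) :
    deriv (fun t => -f (k - t)) t = deriv f (k - t) := by
  have h1 : HasDerivAt (fun t => k - t) (-1) t := by
    simpa using (hasDerivAt_id t).const_sub k
  have h := ((hf (k - t)).hasDerivAt.comp t h1).neg
  rw [mul_neg_one, neg_neg] at h
  exact h.deriv

end Profiles

/-! ### Surjectivity, and the two choices of profile -/

section Bijective

variable {n : ℕ} {a : Fin n → ℝ} {p q : ℝ → ℝ}

lemma norm_scale_le {c : Fin n → ℝ} {m : ℝ} (hm : 0 ≤ m) (hc : ∀ j, |c j| ≤ m) (x : Cn n) :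
    ‖scale c x‖ ≤ m * ‖x‖ := by
  rw [← abs_of_nonneg (norm_nonneg (scale c x)), ← abs_of_nonneg (mul_nonneg hm (norm_nonneg x)),
    ← sq_le_sq, mul_pow, EuclideanSpace.norm_sq_eq, EuclideanSpace.norm_sq_eq, Finset.mul_sum]
  refine Finset.sum_le_sum fun j _ => ?_
  rw [scale_apply, norm_smul, mul_pow, Real.norm_eq_abs]
  gcongr
  exact hc j

lemma le_norm_scale {c : Fin n → ℝ} {m : ℝ} (hm : 0 ≤ m) (hc : ∀ j, m ≤ c j) (x : Cn n) :
    m * ‖x‖ ≤ ‖scale c x‖ := by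
  rw [← abs_of_nonneg (norm_nonneg (scale c x)), ← abs_of_nonneg (mul_nonneg hm (norm_nonneg x)),
    ← sq_le_sq, mul_pow, EuclideanSpace.norm_sq_eq, EuclideanSpace.norm_sq_eq, Finset.mul_sum]
  refine Finset.sum_le_sum fun j _ => ?_
  rw [scale_apply, norm_smul, mul_pow, Real.norm_eq_abs]
  gcongr
  exact (hc j).trans (le_abs_self _)

lemma exists_freq_bounds (ha : ∀ i, 0 < a i) :
    ∃ c C : ℝ, 0 < c ∧ c ≤ C ∧ ∀ j, c ≤ freq a j ∧ freq a j ≤ C := by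
  have hs : 0 ≤ ∑ j, (freq a j)⁻¹ := Finset.sum_nonneg fun j _ => (inv_pos.2 (freq_pos ha j)).le
  have hs' : 0 ≤ ∑ j, freq a j := Finset.sum_nonneg fun j _ => (freq_pos ha j).le
  -- Sums replace the minimum and maximum so that the bounds also make sense for n = 0.
  refine ⟨(1 + ∑ j, (freq a j)⁻¹)⁻¹, 1 + ∑ j, freq a j, by positivity, ?_, fun j => ⟨?_, ?_⟩⟩
  · exact (inv_le_one_of_one_le₀ (by linarith)).trans (by linarith)
  · have h1 := Finset.single_le_sum (f := fun j => (freq a j)⁻¹)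
      (fun j _ => (inv_pos.2 (freq_pos ha j)).le) (Finset.mem_univ j)
    rw [inv_le_comm₀ (by positivity) (freq_pos ha j)]
    linarith
  · have h1 := Finset.single_le_sum (f := freq a)
      (fun j _ => (freq_pos ha j).le) (Finset.mem_univ j)
    linarith

lemma H_bounds {c C : ℝ} (h : ∀ j, c ≤ freq a j ∧ freq a j ≤ C) (x : Cn n) :
    c / 2 * ‖x‖ ^ 2 ≤ H a x ∧ H a x ≤ C / 2 * ‖x‖ ^ 2 := by
  rw [H_eq_sum, EuclideanSpace.norm_sq_eq, Finset.mul_sum, Finset.mul_sum, Finset.mul_sum]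
  constructor <;> refine Finset.sum_le_sum fun j _ => ?_
  · nlinarith [mul_le_mul_of_nonneg_right (h j).1 (sq_nonneg ‖x j‖)]
  · nlinarith [mul_le_mul_of_nonneg_right (h j).2 (sq_nonneg ‖x j‖)]

/-- Logarithmic form of a two-sided bound of `H` by the square of the norm. -/
lemma log_H_bounds {c C : ℝ} (hc : 0 < c) (hC : 0 < C)
    (h : ∀ x : Cn n, c * ‖x‖ ^ 2 ≤ H a x ∧ H a x ≤ C * ‖x‖ ^ 2) {x : Cn n} (hx : x ≠ 0) :
    Real.log c + 2 * Real.log ‖x‖ ≤ Real.log (H a x) ∧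
      Real.log (H a x) ≤ Real.log C + 2 * Real.log ‖x‖ := by
  have hn : 0 < ‖x‖ := norm_pos_iff.2 hx
  have h1 : 0 < c * ‖x‖ ^ 2 := by positivity
  have h2 := Real.log_le_log h1 (h x).1
  have h3 := Real.log_le_log (h1.trans_le (h x).1) (h x).2
  rw [Real.log_mul hc.ne' (by positivity), Real.log_pow] at h2
  rw [Real.log_mul hC.ne' (by positivity), Real.log_pow] at h3
  push_cast at h2 h3
  exact ⟨h2, h3⟩

/-- Properness makes the range closed, and invertibility of the derivative makes the image of ℂⁿ ∖
{0} open. Only 0 maps to 0, so this image is open and closed in ℂⁿ ∖ {0}, which is connected for n ≥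
1. Differentiability at 0 is not needed, which matters for the profile near infinity. -/
lemma stretch_surjective (h : IsProfile a p q) (ha : ∀ i, 0 < a i)
    (hcont : Continuous (stretch a p q))
    (hinf : Tendsto (stretch a p q) (cocompact (Cn n)) (cocompact (Cn n))) :
    Function.Surjective (stretch a p q) := by
  rcases Nat.eq_zero_or_pos n with rfl | hn
  · intro y
    exact ⟨0, Subsingleton.elim _ _⟩
  have hrank : 1 < Module.rank ℝ (Cn n) := by
    rw [← Module.finrank_eq_rank, Nat.one_lt_cast, ← Module.finrank_mul_finrank ℝ ℂ (Cn n)]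
    simp
    omega
  have hconn := (isConnected_compl_singleton_of_one_lt_rank hrank (0 : Cn n)).isPreconnected
  have hclosed : IsClosed (range (stretch a p q)) :=
    (isProperMap_iff_tendsto_cocompact.2 ⟨hcont, hinf⟩).isClosedMap.isClosed_range
  have hopen : IsOpen (stretch a p q '' {0}ᶜ) := by
    rw [isOpen_iff_mem_nhds]
    rintro _ ⟨x, hx, rfl⟩
    have hx0 : x ≠ 0 := hx
    have hs := (contDiffAt_stretch h ha hx0).hasStrictFDerivAt' (hasFDerivAt_stretch h ha hx0)
      (by simp)
    have hsurj := LinearMap.injective_iff_surjective.1 (stretch_fderiv_injective h ha hx0)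
    rw [← hs.map_nhds_eq_of_surj (LinearMap.range_eq_top.2 hsurj)]
    exact image_mem_map (isOpen_compl_singleton.mem_nhds hx)
  obtain ⟨v, hv⟩ : ∃ v : Cn n, v ≠ 0 := by
    have : Nontrivial (Cn n) := rank_pos_iff_nontrivial.1 (zero_lt_one.trans hrank)
    exact exists_ne 0
  have hsub : ({0}ᶜ : Set (Cn n)) ⊆ stretch a p q '' {0}ᶜ := by
    refine hconn.subset_of_closure_inter_subset hopen ?_ ?_
    · exact ⟨stretch a p q v, fun h0 => hv (stretch_eq_zero_iff.1 h0), v, hv, rfl⟩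
    · rintro y ⟨hy, hy0⟩
      obtain ⟨x, rfl⟩ := hclosed.closure_subset_iff.2 (image_subset_range _ _) hy
      refine ⟨x, fun hx => hy0 ?_, rfl⟩
      rw [mem_singleton_iff] at hx ⊢
      rw [hx, stretch_zero]
  intro y
  by_cases hy : y = 0
  · exact ⟨0, by rw [stretch_zero, hy]⟩
  · obtain ⟨x, -, hx⟩ := hsub hy
    exact ⟨x, hx⟩

lemma stretch_continuous (h : IsProfile a p q) (ha : ∀ i, 0 < a i)
    (h0 : ContinuousAt (stretch a p q) 0) : Continuous (stretch a p q) := by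
  rw [continuous_iff_continuousAt]
  intro x
  by_cases hx : x = 0
  · rwa [hx]
  · exact (contDiffAt_stretch h ha hx).continuousAt

/-- A profile whose map is the identity near `0` and standard on the positive end. -/
lemma exists_profile_near_zero (ha : ∀ i, 0 < a i) :
    ∃ p q : ℝ → ℝ, IsProfile a p q ∧
      (∀ x, 1 ≤ H a x → deriv p (Real.log (H a x)) = 1 ∧ deriv q (Real.log ‖x‖) = 1) ∧
      (∃ δ : ℝ, 0 < δ ∧ ∀ x : Cn n, ‖x‖ < δ → stretch a p q x = x) ∧
      Function.Surjective (stretch a p q) := by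
  obtain ⟨β, B, hβ, hβB, hf⟩ := exists_freq_bounds ha
  have hB : 0 < B := hβ.trans_le hβB
  have hlog : ∀ {x : Cn n}, x ≠ 0 → _ :=
    fun hx => log_H_bounds (half_pos hβ) (half_pos hB) (H_bounds hf) hx
  set lc := Real.log (β / 2)
  set lC := Real.log (B / 2)
  have hcC : lc ≤ lC := Real.log_le_log (half_pos hβ) (by linarith)
  -- If H ≥ 1 then log |x| ≥ -lC/2, so with this shift q' = 1 on the end. The shift k₂ makes p turn
  -- on first: wherever log |x| + k₁ ≥ -1 one has log H + k₂ ≥ 2, hence p' = 1 before q' can become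
  -- nonzero.
  set k₁ : ℝ := lC / 2 + 1 with hk₁
  set k₂ : ℝ := lC - lc + 6 with hk₂
  set p : ℝ → ℝ := fun t => ramp (t + k₂) with hp
  set q : ℝ → ℝ := fun t => steepRamp (t + k₁) with hq
  have hdp : ∀ t, deriv p t = deriv ramp (t + k₂) := fun t => deriv_comp_add_const _ _ _
  have hdq : ∀ t, deriv q t = deriv steepRamp (t + k₁) := fun t => deriv_comp_add_const _ _ _
  have hprof : IsProfile a p q := by
    refine ⟨contDiff_ramp.comp (contDiff_id.add contDiff_const),
      contDiff_steepRamp.comp (contDiff_id.add contDiff_const), fun t => ?_, fun t => ?_,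
      fun x hx => ?_⟩
    · rw [hdp]; exact deriv_ramp_nonneg _
    · rw [hdq]; exact deriv_steepRamp_le_one _
    · rw [hdp, hdq]
      rcases lt_or_ge (Real.log ‖x‖ + k₁) (-1) with hlt | hge
      · left; rw [deriv_steepRamp_of_lt hlt]; exact zero_lt_one
      · right
        rw [deriv_ramp_of_one_lt]
        · exact zero_lt_one
        · linarith [(hlog hx).1]
  have hne : ∀ {x : Cn n}, 1 ≤ H a x → x ≠ 0 := by
    rintro x hx rfl
    rw [H_zero] at hx
    linarith
  have hid : ∃ δ : ℝ, 0 < δ ∧ ∀ x : Cn n, ‖x‖ < δ → stretch a p q x = x := by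
    refine ⟨Real.exp (-k₂ - lC / 2), Real.exp_pos _, fun x hx => ?_⟩
    by_cases hx0 : x = 0
    · rw [hx0, stretch_zero]
    have h1 := (Real.log_lt_iff_lt_exp (norm_pos_iff.2 hx0)).2 hx
    refine stretch_eq_self (ramp_of_nonpos ?_) (steepRamp_of_le ?_)
    · linarith [(hlog hx0).2]
    · linarith
  refine ⟨p, q, hprof, fun x hx => ⟨?_, ?_⟩, hid, ?_⟩
  · rw [hdp]
    exact deriv_ramp_of_one_lt (by linarith [Real.log_nonneg hx])
  · rw [hdq]
    exact deriv_steepRamp_of_pos (by linarith [Real.log_nonneg hx, (hlog (hne hx)).2])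
  · refine stretch_surjective hprof ha (stretch_continuous hprof ha ?_) ?_
    · obtain ⟨δ, hδ, h⟩ := hid
      refine continuousAt_id.congr ?_
      filter_upwards [Metric.ball_mem_nhds 0 hδ] with x hx
      exact (h x (by simpa using hx)).symm
    · rw [← Metric.cobounded_eq_cocompact, ← tendsto_norm_atTop_iff_cobounded]
      -- Far out q cancels |x| up to a constant, and each factor of the first kind is at least
      -- e^{β(log H + k₂)}, so this is a lower bound for the norm of the image; it gives properness.
      have hlim : Tendsto (fun x : Cn n => Real.exp (β * (lc + 2 * Real.log ‖x‖ + k₂) - k₁))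
          (Bornology.cobounded (Cn n)) atTop := by
        refine Real.tendsto_exp_atTop.comp (tendsto_atTop_add_const_right _ _
          (Tendsto.const_mul_atTop hβ (tendsto_atTop_add_const_right _ _
          (tendsto_atTop_add_const_left _ _ (Tendsto.const_mul_atTop two_pos
          (Real.tendsto_log_atTop.comp tendsto_norm_cobounded_atTop))))))
      refine tendsto_atTop_mono' _ ?_ hlim
      have hev : ∀ᶠ x : Cn n in Bornology.cobounded (Cn n),
          Real.exp (1 - lc + |lC|) < ‖x‖ :=
        tendsto_norm_cobounded_atTop.eventually_gt_atTop _
      have hev2 : ∀ᶠ x : Cn n in Bornology.cobounded (Cn n),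
          Real.exp (|lC| + |lc|) < ‖x‖ :=
        tendsto_norm_cobounded_atTop.eventually_gt_atTop _
      filter_upwards [hev, hev2] with x hx hx2
      have hn : 0 < ‖x‖ := (Real.exp_pos _).trans hx
      have hx0 : x ≠ 0 := norm_pos_iff.1 hn
      have hl2 := (Real.lt_log_iff_exp_lt hn).2 hx2
      have hb := (hlog hx0).1
      have habs := abs_nonneg lC
      have habs1 := neg_abs_le lC
      have habs2 := neg_abs_le lc
      have habs3 := abs_nonneg lc
      have ep : p (Real.log (H a x)) = Real.log (H a x) + k₂ := ramp_of_one_le (by linarith)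
      have eq' : q (Real.log ‖x‖) = Real.log ‖x‖ + k₁ := steepRamp_of_nonneg (by linarith)
      have hfac : ∀ j, Real.exp (β * (lc + 2 * Real.log ‖x‖ + k₂) - (Real.log ‖x‖ + k₁)) ≤
          stretchFactor a p q x j := by
        intro j
        rw [stretchFactor, ep, eq', Real.exp_le_exp]
        have : β * (lc + 2 * Real.log ‖x‖ + k₂) ≤ freq a j * (Real.log (H a x) + k₂) :=
          mul_le_mul (hf j).1 (by linarith) (by linarith) (freq_pos ha j).le
        linarith
      refine le_trans (le_of_eq ?_) (le_norm_scale (Real.exp_pos _).le hfac x)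
      rw [show β * (lc + 2 * Real.log ‖x‖ + k₂) - (Real.log ‖x‖ + k₁) =
        β * (lc + 2 * Real.log ‖x‖ + k₂) - k₁ - Real.log ‖x‖ by ring,
        Real.exp_sub _ (Real.log ‖x‖), Real.exp_log hn,
        div_mul_cancel₀ _ hn.ne']

/-- A profile whose map is the identity outside a ball and standard on the negative end. -/
lemma exists_profile_near_infinity (ha : ∀ i, 0 < a i) {β B : ℝ} (hβ : 0 < β) (hβB : β ≤ B)
    (hf : ∀ j, β ≤ freq a j ∧ freq a j ≤ B) :
    ∃ p q : ℝ → ℝ, IsProfile a p q ∧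
      (∀ x, x ≠ 0 → H a x ≤ 1 →
        deriv p (Real.log (H a x)) = 1 ∧ deriv q (Real.log ‖x‖) = 1) ∧
      (∀ x : Cn n, Real.exp (3 + Real.log (B / 2) / 2 - Real.log (β / 2)) ≤ ‖x‖ →
        stretch a p q x = x) ∧
      Function.Surjective (stretch a p q) := by
  have hB : 0 < B := hβ.trans_le hβB
  have hlog : ∀ {x : Cn n}, x ≠ 0 → _ :=
    fun hx => log_H_bounds (half_pos hβ) (half_pos hB) (H_bounds hf) hx
  set lc := Real.log (β / 2)
  set lC := Real.log (B / 2)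
  have hcC : lc ≤ lC := Real.log_le_log (half_pos hβ) (by linarith)
  -- The previous profile reflected. If H ≤ 1 then log |x| ≤ -lc/2, so q' = 1; wherever k₁ - log |x|
  -- ≥ -1 one has k₂ - log H ≥ 2, so p' = 1. For log |x| ≥ 3 + lC/2 - lc both functions vanish,
  -- which is the radius in the statement.
  set k₁ : ℝ := -lc / 2 + 1 with hk₁
  set k₂ : ℝ := lC - lc + 6 with hk₂
  set p : ℝ → ℝ := fun t => -ramp (k₂ - t) with hp
  set q : ℝ → ℝ := fun t => -steepRamp (k₁ - t) with hq
  have hdp : ∀ t, deriv p t = deriv ramp (k₂ - t) :=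
    deriv_neg_comp_sub _ (contDiff_ramp.differentiable (by simp)) _
  have hdq : ∀ t, deriv q t = deriv steepRamp (k₁ - t) :=
    deriv_neg_comp_sub _ (contDiff_steepRamp.differentiable (by simp)) _
  have hprof : IsProfile a p q := by
    refine ⟨(contDiff_ramp.comp (contDiff_const.sub contDiff_id)).neg,
      (contDiff_steepRamp.comp (contDiff_const.sub contDiff_id)).neg, fun t => ?_, fun t => ?_,
      fun x hx => ?_⟩
    · rw [hdp]; exact deriv_ramp_nonneg _
    · rw [hdq]; exact deriv_steepRamp_le_one _
    · rw [hdp, hdq]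
      rcases lt_or_ge (k₁ - Real.log ‖x‖) (-1) with hlt | hge
      · left; rw [deriv_steepRamp_of_lt hlt]; exact zero_lt_one
      · right
        rw [deriv_ramp_of_one_lt]
        · exact zero_lt_one
        · linarith [(hlog hx).2]
  have hid : ∀ x : Cn n, Real.exp (3 + lC / 2 - lc) ≤ ‖x‖ → stretch a p q x = x := by
    intro x hx
    have hn : 0 < ‖x‖ := (Real.exp_pos _).trans_le hx
    have h1 := (Real.le_log_iff_exp_le hn).2 hx
    refine stretch_eq_self (neg_eq_zero.2 (ramp_of_nonpos ?_))
      (neg_eq_zero.2 (steepRamp_of_le ?_))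
    · linarith [(hlog (norm_pos_iff.1 hn)).1]
    · linarith
  refine ⟨p, q, hprof, fun x hx0 hx => ⟨?_, ?_⟩, hid, ?_⟩
  · have := Real.log_nonpos (H_pos ha hx0).le hx
    rw [hdp]
    exact deriv_ramp_of_one_lt (by linarith)
  · have := Real.log_nonpos (H_pos ha hx0).le hx
    rw [hdq]
    exact deriv_steepRamp_of_pos (by linarith [(hlog hx0).1])
  · refine stretch_surjective hprof ha (stretch_continuous hprof ha ?_) ?_
    -- Near 0 the modulus of the image is at most a constant times e^{β log H}, because q cancels
    -- |x| and the frequencies are at least β while log H - k₂ < 0. Hence the map is continuous at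
    -- 0.
    · rw [← continuousWithinAt_compl_self]
      have hl : Tendsto (fun x : Cn n => Real.log ‖x‖) (𝓝[≠] 0) atBot :=
        Real.tendsto_log_nhdsGT_zero.comp tendsto_norm_nhdsNE_zero
      have hlim : Tendsto (fun x : Cn n => Real.exp (β * (lC + 2 * Real.log ‖x‖ - k₂) + k₁))
          (𝓝[≠] 0) (𝓝 0) := by
        refine Real.tendsto_exp_atBot.comp (tendsto_atBot_add_const_right _ _
          (Tendsto.const_mul_atBot hβ ?_))
        simp only [sub_eq_add_neg]
        exact tendsto_atBot_add_const_right _ _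
          (tendsto_atBot_add_const_left _ _ (Tendsto.const_mul_atBot two_pos hl))
      rw [ContinuousWithinAt, stretch_zero]
      refine squeeze_zero_norm' ?_ hlim
      filter_upwards [hl.eventually_lt_atBot (-|lC| - |lc|), self_mem_nhdsWithin] with x hl2 hx0
      have hx0 : x ≠ 0 := hx0
      have hn : 0 < ‖x‖ := norm_pos_iff.2 hx0
      have hb := (hlog hx0).2
      have habs := abs_nonneg lC
      have habs1 := le_abs_self lC
      have habs2 := le_abs_self lc
      have habs3 := abs_nonneg lc
      have ep : p (Real.log (H a x)) = Real.log (H a x) - k₂ := by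
        simp only [p]; rw [ramp_of_one_le (by linarith)]; ring
      have eq' : q (Real.log ‖x‖) = Real.log ‖x‖ - k₁ := by
        simp only [q]; rw [steepRamp_of_nonneg (by linarith)]; ring
      have hfac : ∀ j, |stretchFactor a p q x j| ≤
          Real.exp (β * (lC + 2 * Real.log ‖x‖ - k₂) + k₁ - Real.log ‖x‖) := by
        intro j
        rw [abs_of_pos (stretchFactor_pos x j), stretchFactor, ep, eq', Real.exp_le_exp]
        have h1 : freq a j * (Real.log (H a x) - k₂) ≤ β * (Real.log (H a x) - k₂) :=
          mul_le_mul_of_nonpos_right (hf j).1 (by linarith)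
        have h2 : β * (Real.log (H a x) - k₂) ≤ β * (lC + 2 * Real.log ‖x‖ - k₂) :=
          mul_le_mul_of_nonneg_left (by linarith) hβ.le
        linarith
      refine (norm_scale_le (Real.exp_pos _).le hfac x).trans (le_of_eq ?_)
      rw [Real.exp_sub _ (Real.log ‖x‖), Real.exp_log hn, div_mul_cancel₀ _ hn.ne']
    · refine tendsto_id.congr' ?_
      rw [← Metric.cobounded_eq_cocompact]
      filter_upwards [tendsto_norm_cobounded_atTop.eventually_ge_atTop
        (Real.exp (3 + lC / 2 - lc))] with x hx
      exact (hid x hx).symm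

end Bijective

/-! ### The almost complex structure on the cylindrical end -/

section CylindricalEnd

variable {n : ℕ} {a : Fin n → ℝ}

/-- `(ρ, v) ↦ ρ R' + v - ⟨z, v⟩ z / |z|²`, where `i R'` is the Reeb vector at `z ∈ ∂E(a)`. -/
def endMap (a : Fin n → ℝ) (z : Cn n) : ℝ × Cn n →L[ℝ] Cn n :=
  (ContinuousLinearMap.fst ℝ ℝ (Cn n)).smulRight (scale (freq a) z)
    + ContinuousLinearMap.snd ℝ ℝ (Cn n)
    - ((⟪z, z⟫)⁻¹ • innerSL ℝ z ∘L ContinuousLinearMap.snd ℝ ℝ (Cn n)).smulRight z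

lemma endMap_apply (z : Cn n) (u : ℝ × Cn n) :
    endMap a z u = u.1 • scale (freq a) z + u.2 - ((⟪z, z⟫)⁻¹ * ⟪z, u.2⟫) • z := by
  simp [endMap]

/-- The `ℝ`-component of the almost complex structure of the end. -/
def endJFst (a : Fin n → ℝ) (z : Cn n) (u : ℝ × Cn n) : ℝ :=
  (⟪scale (freq a) z, z⟫)⁻¹ * ⟪z, mulI n u.2⟫

/-- The `∂E(a)`-component of the almost complex structure of the end, up to multiples of `z`. -/
def endJSnd (a : Fin n → ℝ) (z : Cn n) (u : ℝ × Cn n) : Cn n :=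
  mulI n (endMap a z u) - endJFst a z u • scale (freq a) z

/-- The almost complex structure of the cylindrical end induced by the standard one, the
`∂E(a)`-component of a vector being projected along `z`. -/
def endJ (a : Fin n → ℝ) (x : ℝ × Cn n) : ℝ × Cn n →L[ℝ] ℝ × Cn n :=
  LinearMap.toContinuousLinearMap
    { toFun := fun u => (endJFst a x.2 u, endJSnd a x.2 u -
        ((⟪scale (freq a) x.2, x.2⟫)⁻¹ * ⟪scale (freq a) x.2, endJSnd a x.2 u⟫) • x.2)
      map_add' := fun u v => by
        simp only [endJFst, endJSnd, Prod.snd_add, map_add, inner_add_right, inner_sub_right,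
          real_inner_smul_right, Prod.mk_add_mk, Prod.mk.injEq]
        exact ⟨by ring, by module⟩
      map_smul' := fun c u => by
        simp only [endJFst, endJSnd, Prod.smul_snd, map_smul, inner_sub_right,
          real_inner_smul_right, Prod.smul_mk, Prod.mk.injEq, RingHom.id_apply, smul_eq_mul]
        exact ⟨by ring, by module⟩ }

lemma endJ_apply (x u : ℝ × Cn n) : endJ a x u = (endJFst a x.2 u, endJSnd a x.2 u -
    ((⟪scale (freq a) x.2, x.2⟫)⁻¹ * ⟪scale (freq a) x.2, endJSnd a x.2 u⟫) • x.2) := rfl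

lemma inner_scale_freq_pos (ha : ∀ i, 0 < a i) {z : Cn n} (hz : z ≠ 0) :
    0 < ⟪scale (freq a) z, z⟫ := by
  have := H_pos ha hz
  rw [H_eq_inner] at this
  linarith

lemma endJ_tangent (ha : ∀ i, 0 < a i) (r : ℝ) {z : Cn n} (hz : z ≠ 0) (u : ℝ × Cn n) :
    (endJ a (r, z) u).2 ∈ bdryTangent a z := by
  have := (inner_scale_freq_pos ha hz).ne'
  rw [mem_bdryTangent, endJ_apply]
  simp only [inner_sub_right, real_inner_smul_right]
  field_simp
  simp

/-- `endJFst` is chosen so that `endJSnd` is orthogonal to z. The multiple of z subtracted in `endJ`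
to return to the tangent space of ∂E(a) is then exactly what the projection in `endMap` removes.
This relation says that `endJ` is the pullback of i by `endMap`. -/
lemma endMap_endJ (ha : ∀ i, 0 < a i) (r : ℝ) {z : Cn n} (hz : z ≠ 0) (u : ℝ × Cn n) :
    endMap a z (endJ a (r, z) u) = mulI n (endMap a z u) := by
  have hzz : ⟪z, z⟫ ≠ 0 := (real_inner_self_pos.2 hz).ne'
  have hbz := (inner_scale_freq_pos ha hz).ne'
  have hX : ⟪z, endJSnd a z u⟫ = 0 := by
    rw [endJSnd, endMap_apply, endJFst]
    simp only [map_sub, map_add, map_smul, inner_sub_right, inner_add_right,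
      real_inner_smul_right, inner_mulI_scale, inner_self_mulI]
    rw [real_inner_comm (scale (freq a) z) z]
    field_simp
    ring
  rw [endMap_apply, endJ_apply]
  simp only [inner_sub_right, real_inner_smul_right, hX]
  rw [zero_sub, mul_neg, mul_left_comm, inv_mul_cancel₀ hzz, mul_one, endJSnd]
  module

/-- Pairing with z isolates the ℝ-component. The rest is then a multiple of z, and z is transverse
to ∂E(a). -/
lemma endMap_injOn (ha : ∀ i, 0 < a i) {z : Cn n} (hz : z ≠ 0) {u : ℝ × Cn n}
    (hu : u.2 ∈ bdryTangent a z) (h : endMap a z u = 0) : u = 0 := by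
  have hzz : ⟪z, z⟫ ≠ 0 := (real_inner_self_pos.2 hz).ne'
  have hbz := (inner_scale_freq_pos ha hz).ne'
  rw [mem_bdryTangent] at hu
  rw [endMap_apply] at h
  have h1 : u.1 = 0 := by
    have := congrArg (fun w => ⟪z, w⟫) h
    simp only [inner_sub_right, inner_add_right, real_inner_smul_right, inner_zero_right] at this
    rw [real_inner_comm (scale (freq a) z) z, mul_right_comm, inv_mul_cancel₀ hzz, one_mul,
      add_sub_cancel_right] at this
    exact (mul_eq_zero.1 this).resolve_right hbz
  rw [h1, zero_smul, zero_add, sub_eq_zero] at h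
  have h2 : (⟪z, z⟫)⁻¹ * ⟪z, u.2⟫ = 0 := by
    rw [h, real_inner_smul_right] at hu
    exact (mul_eq_zero.1 hu).resolve_right hbz
  rw [h2, zero_smul] at h
  exact Prod.ext h1 h

lemma contDiffOn_endJ (ha : ∀ i, 0 < a i) : ContDiffOn ℝ ∞ (endJ a) (univ ×ˢ {0}ᶜ) := by
  rw [contDiffOn_clm_apply]
  intro u
  have hz : ContDiffOn ℝ ∞ (fun x : ℝ × Cn n => x.2) (univ ×ˢ {0}ᶜ) := contDiff_snd.contDiffOn
  have hb : ContDiffOn ℝ ∞ (fun x : ℝ × Cn n => scale (freq a) x.2) (univ ×ˢ {0}ᶜ) :=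
    (scale (freq a)).contDiff.comp_contDiffOn hz
  have hbi : ContDiffOn ℝ ∞ (fun x : ℝ × Cn n => (⟪scale (freq a) x.2, x.2⟫)⁻¹)
      (univ ×ˢ {0}ᶜ) :=
    (hb.inner ℝ hz).inv fun x hx => (inner_scale_freq_pos ha hx.2).ne'
  have hzi : ContDiffOn ℝ ∞ (fun x : ℝ × Cn n => (⟪x.2, x.2⟫)⁻¹) (univ ×ˢ {0}ᶜ) :=
    (hz.inner ℝ hz).inv fun x hx => (real_inner_self_pos.2 hx.2).ne'
  have h1 : ContDiffOn ℝ ∞ (fun x : ℝ × Cn n => endJFst a x.2 u) (univ ×ˢ {0}ᶜ) :=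
    hbi.mul (hz.inner ℝ (contDiffOn_const (c := mulI n u.2)))
  have hL : ContDiffOn ℝ ∞ (fun x : ℝ × Cn n => endMap a x.2 u) (univ ×ˢ {0}ᶜ) := by
    simp only [endMap_apply]
    exact ((hb.const_smul u.1).add (contDiffOn_const (c := u.2))).sub
      ((hzi.mul (hz.inner ℝ (contDiffOn_const (c := u.2)))).smul hz)
  have h2 : ContDiffOn ℝ ∞ (fun x : ℝ × Cn n => endJSnd a x.2 u) (univ ×ˢ {0}ᶜ) :=
    ((mulI n).contDiff.comp_contDiffOn hL).sub (h1.smul hb)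
  exact h1.prodMk (h2.sub ((hbi.mul (hb.inner ℝ h2)).smul hz))

lemma ne_zero_of_mem_bdry {z : Cn n} (hz : z ∈ ellipsoidBdry a) : z ≠ 0 := by
  rintro rfl
  rw [ellipsoidBdry, mem_ofPred_eq, H_zero] at hz
  exact zero_ne_one hz

lemma inner_scale_freq_of_mem_bdry {z : Cn n} (hz : z ∈ ellipsoidBdry a) :
    ⟪scale (freq a) z, z⟫ = 2 := by
  have h : H a z = 1 := hz
  rw [H_eq_inner] at h
  linarith

lemma mem_contactPlane {z v : Cn n} :
    v ∈ contactPlane a z ↔ ⟪scale (freq a) z, v⟫ = 0 ∧ ⟪z, mulI n v⟫ = 0 := by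
  rw [contactPlane, mem_ofPred_eq, mem_bdryTangent, lam_eq_inner, inner_mulI_left]
  simp

lemma isReeb_mulI_scale (z : Cn n) (hz : z ∈ ellipsoidBdry a) :
    IsReeb a z (mulI n (scale (freq a) z)) where
  tangent := by rw [mem_bdryTangent, inner_self_mulI]
  ker v hv := by
    rw [mem_bdryTangent] at hv
    rw [stdForm_apply, mulI_mulI, inner_neg_left, hv, neg_zero]
  normalized := by
    rw [lam_eq_inner, inner_mulI_mulI, real_inner_comm, inner_scale_freq_of_mem_bdry hz]
    norm_num

/-- On the contact plane the almost complex structure is `i` applied to the component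
complex-orthogonal to `z`, corrected by a multiple of `z`. -/
lemma endJ_contact (r : ℝ) {z v : Cn n} (hv : v ∈ contactPlane a z) :
    ∃ β : ℝ, endJ a (r, z) (0, v) =
      (0, mulI n (v - ((⟪z, z⟫)⁻¹ * ⟪z, v⟫) • z) - β • z) := by
  rw [mem_contactPlane] at hv
  refine ⟨(⟪scale (freq a) z, z⟫)⁻¹ * ⟪scale (freq a) z, endJSnd a z (0, v)⟫, ?_⟩
  rw [endJ_apply]
  simp only [endJSnd, endJFst, hv.2, mul_zero, zero_smul, sub_zero, endMap_apply, zero_add]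

lemma inner_orth_mulI {z v : Cn n} (hv : v ∈ contactPlane a z) (c : ℝ) :
    ⟪v - c • z, mulI n z⟫ = 0 := by
  rw [mem_contactPlane] at hv
  rw [inner_sub_left, real_inner_smul_left, inner_self_mulI, real_inner_comm, inner_mulI_left,
    hv.2]
  simp

lemma inner_orth {z : Cn n} (hz : z ≠ 0) (v : Cn n) :
    ⟪v - ((⟪z, z⟫)⁻¹ * ⟪z, v⟫) • z, z⟫ = 0 := by
  have hzz : ⟪z, z⟫ ≠ 0 := (real_inner_self_pos.2 hz).ne'
  rw [inner_sub_left, real_inner_smul_left, real_inner_comm v z]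
  field_simp
  simp

/-- On ξ_z, projecting off z lands in the complex orthogonal complement of z, where i acts. Vectors
of ξ_z are ω-orthogonal to z, so this projection preserves dα and compatibility reduces to that of
i. -/
lemma isSFTAdmissible_endJ (ha : ∀ i, 0 < a i) : IsSFTAdmissible a (endJ a) where
  smooth := contDiffOn_endJ ha
  tangent r z hz u _ := endJ_tangent ha r (ne_zero_of_mem_bdry hz) u
  sq r z hz u hu := by
    have hz0 := ne_zero_of_mem_bdry hz
    rw [← add_eq_zero_iff_eq_neg]
    refine endMap_injOn ha hz0 (Submodule.add_mem _ (endJ_tangent ha r hz0 _) hu) ?_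
    rw [map_add, endMap_endJ ha r hz0, endMap_endJ ha r hz0, mulI_mulI, neg_add_cancel]
  translation _ _ _ _ _ _ := rfl
  reeb r z hz := by
    refine ⟨_, isReeb_mulI_scale z hz, ?_⟩
    rw [endJ_apply]
    simp [endJSnd, endJFst, endMap_apply, inner_self_mulI]
  contact r z hz v hv := by
    have hz0 := ne_zero_of_mem_bdry hz
    obtain ⟨β, hβ⟩ := endJ_contact r hv
    have ht := endJ_tangent ha r hz0 (0, v)
    rw [hβ] at ht ⊢
    refine ⟨rfl, ht, ?_⟩
    rw [lam_eq_inner, inner_sub_right, real_inner_smul_right, inner_mulI_mulI, real_inner_comm,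
      inner_orth hz0, inner_mulI_left, inner_self_mulI]
    simp
  invariant r z hz v hv w hw := by
    have hz0 := ne_zero_of_mem_bdry hz
    obtain ⟨β, hβ⟩ := endJ_contact r hv
    obtain ⟨γ, hγ⟩ := endJ_contact r hw
    rw [hβ, hγ]
    set c := (⟪z, z⟫)⁻¹ * ⟪z, v⟫
    set d := (⟪z, z⟫)⁻¹ * ⟪z, w⟫
    have hv1 : ⟪v - c • z, z⟫ = 0 := inner_orth hz0 v
    have hw1 : ⟪w - d • z, z⟫ = 0 := inner_orth hz0 w
    have hv2 := inner_orth_mulI hv c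
    have hw2 := inner_orth_mulI hw d
    have hvz : ⟪v, mulI n z⟫ = 0 := by simpa using inner_orth_mulI hv 0
    have hwz : ⟪mulI n z, w⟫ = 0 := by
      rw [real_inner_comm]; simpa using inner_orth_mulI hw 0
    have e : ⟪mulI n (v - c • z), w - d • z⟫ = ⟪mulI n v, w⟫ := by
      rw [map_sub, map_smul]
      simp only [inner_sub_left, inner_sub_right, real_inner_smul_left, real_inner_smul_right,
        hwz, inner_mulI_left v z, inner_mulI_left z z, hvz, inner_self_mulI]
      ring
    rw [stdForm_apply, stdForm_apply, ← e]
    simp only [map_sub (mulI n) _ (β • z), map_smul, mulI_mulI, inner_sub_left _ (β • mulI n z),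
      inner_sub_right _ _ (γ • z), real_inner_smul_left, real_inner_smul_right, inner_neg_left,
      hv1, inner_mulI_mulI, inner_mulI_left z z, inner_self_mulI, real_inner_comm (w - d • z) z,
      hw1]
    rw [inner_mulI_left]
    ring
  positive r z hz v hv hv0 := by
    have hz0 := ne_zero_of_mem_bdry hz
    obtain ⟨β, hβ⟩ := endJ_contact r hv
    rw [hβ]
    set c := (⟪z, z⟫)⁻¹ * ⟪z, v⟫
    have hv1 : ⟪v - c • z, z⟫ = 0 := inner_orth hz0 v
    have hvz : ⟪v, mulI n z⟫ = 0 := by simpa using inner_orth_mulI hv 0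
    have e : ⟪mulI n v, mulI n (v - c • z) - β • z⟫ = ⟪v - c • z, v - c • z⟫ := by
      rw [inner_sub_right, real_inner_smul_right, inner_mulI_mulI, inner_mulI_left v z, hvz,
        inner_sub_right (v - c • z), real_inner_smul_right (v - c • z), hv1, real_inner_comm]
      simp
    rw [stdForm_apply, e]
    refine real_inner_self_pos.2 fun h0 => hv0 ?_
    rw [sub_eq_zero] at h0
    have h1 := (mem_contactPlane.1 hv).1
    rw [h0, real_inner_smul_right, inner_scale_freq_of_mem_bdry hz] at h1
    rw [h0, show c = 0 by linarith, zero_smul]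

lemma hasFDerivAt_F (r : ℝ) (z : Cn n) :
    HasFDerivAt (F : ℝ × Cn n → Cn n)
      (Real.exp (r / 2) • ((ContinuousLinearMap.fst ℝ ℝ (Cn n)).smulRight ((1 / 2 : ℝ) • z)
        + ContinuousLinearMap.snd ℝ ℝ (Cn n))) (r, z) := by
  have h1 : HasFDerivAt (fun p : ℝ × Cn n => Real.exp (p.1 / 2)) _ (r, z) :=
    ((hasFDerivAt_fst (𝕜 := ℝ) (p := (r, z))).mul_const (2⁻¹ : ℝ)).exp
  have h2 := h1.smul (hasFDerivAt_snd (𝕜 := ℝ) (p := (r, z)))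
  refine h2.congr_fderiv ?_
  refine ContinuousLinearMap.ext fun u => ?_
  simp [div_eq_mul_inv]
  module

lemma norm_F_sq (r : ℝ) (z : Cn n) : ‖F (r, z)‖ ^ 2 = Real.exp (r / 2) ^ 2 * ‖z‖ ^ 2 := by
  rw [F, norm_smul, mul_pow, Real.norm_eq_abs, sq_abs]

/-- Where the profile is standard, `stretch` composed with the trivialization of the end has
derivative `endMap`, up to a diagonal factor. -/
lemma stretchDeriv_F {p q : ℝ → ℝ} {r : ℝ} {z : Cn n} (hz : z ∈ ellipsoidBdry a)
    (hp : deriv p (Real.log (H a (F (r, z)))) = 1) (hq : deriv q (Real.log ‖F (r, z)‖) = 1)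
    {u : ℝ × Cn n} (hu : u.2 ∈ bdryTangent a z) :
    stretchDeriv a p q (F (r, z)) (fderiv ℝ F (r, z) u) = Real.exp (r / 2) • endMap a z u := by
  have hz0 := ne_zero_of_mem_bdry hz
  have hzz : ⟪z, z⟫ ≠ 0 := (real_inner_self_pos.2 hz0).ne'
  have he := (Real.exp_pos (r / 2)).ne'
  have he2 : Real.exp r = Real.exp (r / 2) ^ 2 := by
    rw [← Real.exp_nat_mul]; congr 1; push_cast; ring
  rw [mem_bdryTangent] at hu
  rw [(hasFDerivAt_F r z).fderiv, stretchDeriv, rankTwo_apply, endMap_apply, hp, hq, norm_F_sq,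
    H_F, show H a z = 1 from hz, ← real_inner_self_eq_norm_sq, F, he2]
  simp only [_root_.smul_apply, _root_.add_apply, ContinuousLinearMap.smulRight_apply,
    ContinuousLinearMap.coe_fst', ContinuousLinearMap.coe_snd', map_smul, real_inner_smul_left,
    real_inner_smul_right, inner_add_right, hu, inner_scale_freq_of_mem_bdry hz]
  match_scalars <;> field_simp <;> ring

end CylindricalEnd

/-! ### From bijective local diffeomorphisms to diffeomorphisms -/

section Diffeomorphisms

variable {n : ℕ} {M : Type*} [TopologicalSpace M] [ChartedSpace (Cn n) M]
  {N : Type*} [TopologicalSpace N] [ChartedSpace (Cn n) N]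

lemma contMDiff_codRestrict {U : TopologicalSpace.Opens M} {f : N → U}
    (hf : ContMDiff 𝓘(ℝ, Cn n) 𝓘(ℝ, Cn n) ∞ fun x => (f x : M)) :
    ContMDiff 𝓘(ℝ, Cn n) 𝓘(ℝ, Cn n) ∞ f := by
  intro x
  have h := contMDiffAt_iff.1 (hf x)
  exact contMDiffAt_iff.2 ⟨IsInducing.subtypeVal.continuousAt_iff.2 h.1, h.2⟩

variable [IsManifold 𝓘(ℝ, Cn n) ∞ M] [IsManifold 𝓘(ℝ, Cn n) ∞ N]

/-- The inverse of an injective local diffeomorphism is smooth. -/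
lemma contMDiffAt_of_leftInverse {f : N → M} (hf : ContMDiff 𝓘(ℝ, Cn n) 𝓘(ℝ, Cn n) ∞ f)
    (hf' : ∀ x, (mfderiv 𝓘(ℝ, Cn n) 𝓘(ℝ, Cn n) f x).IsInvertible) {g : M → N}
    (hgf : Function.LeftInverse g f) (x : N) :
    ContMDiffAt 𝓘(ℝ, Cn n) 𝓘(ℝ, Cn n) ∞ g (f x) := by
  obtain ⟨h, hh, he⟩ := exists_local_inverse (hf x) (hf' x)
  refine hh.congr_of_eventuallyEq ?_
  filter_upwards [he] with y hy
  rw [← hgf (h y), hy]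

lemma exists_diffeomorph {f : N → M} (hf : ContMDiff 𝓘(ℝ, Cn n) 𝓘(ℝ, Cn n) ∞ f)
    (hf' : ∀ x, (mfderiv 𝓘(ℝ, Cn n) 𝓘(ℝ, Cn n) f x).IsInvertible)
    (hbij : Function.Bijective f) :
    ∃ Q : N ≃ₘ^∞⟮𝓘(ℝ, Cn n), 𝓘(ℝ, Cn n)⟯ M, ⇑Q = f := by
  refine ⟨{ Equiv.ofBijective f hbij with
    contMDiff_toFun := hf
    contMDiff_invFun := fun y => ?_ }, rfl⟩
  obtain ⟨x, rfl⟩ := hbij.2 y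
  exact contMDiffAt_of_leftInverse hf hf' (Equiv.ofBijective f hbij).left_inv x

lemma exists_diffeomorph_opens {U : TopologicalSpace.Opens M} {f : N → M}
    (hf : ContMDiff 𝓘(ℝ, Cn n) 𝓘(ℝ, Cn n) ∞ f)
    (hf' : ∀ x, (mfderiv 𝓘(ℝ, Cn n) 𝓘(ℝ, Cn n) f x).IsInvertible)
    (hinj : Function.Injective f) (hrange : range f = U) :
    ∃ Q : N ≃ₘ^∞⟮𝓘(ℝ, Cn n), 𝓘(ℝ, Cn n)⟯ U, ∀ x, (Q x : M) = f x := by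
  let e : N ≃ U := (Equiv.ofInjective f hinj).trans (Equiv.setCongr hrange)
  have he : ∀ x, (e x : M) = f x := fun x => rfl
  refine ⟨{ e with
    contMDiff_toFun := contMDiff_codRestrict hf
    contMDiff_invFun := fun y => ?_ }, he⟩
  obtain ⟨x, rfl⟩ := e.surjective y
  have : Nonempty N := ⟨x⟩
  have h := (contMDiffAt_of_leftInverse hf hf' (Function.leftInverse_invFun hinj) x).comp (e x)
    (contMDiff_subtype_val (U := U) (e x))
  refine h.congr_of_eventuallyEq (Eventually.of_forall fun y => ?_)
  obtain ⟨x', rfl⟩ := e.surjective y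
  change e.symm (e x') = Function.invFun f (e x')
  rw [e.symm_apply_apply, he, Function.leftInverse_invFun hinj]

end Diffeomorphisms

/-! ### Transporting a map of ℂⁿ through a chart -/

section Transplant

variable {n : ℕ} {M : Type*} [TopologicalSpace M]

open Classical in
/-- A self-map of `ℂⁿ` transported to `M` by a chart, extended by the identity. -/
def transplant (ζ : OpenPartialHomeomorph M (Cn n)) (φ : Cn n → Cn n) (x : M) : M :=
  if x ∈ ζ.source then ζ.symm (φ (ζ x)) else x

variable {ζ : OpenPartialHomeomorph M (Cn n)} {φ : Cn n → Cn n}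

lemma transplant_of_mem {x : M} (hx : x ∈ ζ.source) :
    transplant ζ φ x = ζ.symm (φ (ζ x)) := if_pos hx

lemma transplant_of_notMem {x : M} (hx : x ∉ ζ.source) : transplant ζ φ x = x := if_neg hx

lemma transplant_mem_source_iff (h : MapsTo φ ζ.target ζ.target) {x : M} :
    transplant ζ φ x ∈ ζ.source ↔ x ∈ ζ.source := by
  by_cases hx : x ∈ ζ.source
  · rw [transplant_of_mem hx]
    exact ⟨fun _ => hx, fun _ => ζ.map_target (h (ζ.map_source hx))⟩
  · rw [transplant_of_notMem hx]

lemma chart_transplant (h : MapsTo φ ζ.target ζ.target) {x : M} (hx : x ∈ ζ.source) :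
    ζ (transplant ζ φ x) = φ (ζ x) := by
  rw [transplant_of_mem hx, ζ.right_inv (h (ζ.map_source hx))]

lemma transplant_bijective (h : BijOn φ ζ.target ζ.target) :
    Function.Bijective (transplant ζ φ) := by
  constructor
  · intro x y hxy
    have hiff : x ∈ ζ.source ↔ y ∈ ζ.source := by
      rw [← transplant_mem_source_iff h.mapsTo, hxy, transplant_mem_source_iff h.mapsTo]
    by_cases hx : x ∈ ζ.source
    · have hy := hiff.1 hx
      have := congrArg ζ hxy
      rw [chart_transplant h.mapsTo hx, chart_transplant h.mapsTo hy] at this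
      exact ζ.injOn hx hy (h.injOn (ζ.map_source hx) (ζ.map_source hy) this)
    · rwa [transplant_of_notMem hx, transplant_of_notMem fun hy => hx (hiff.2 hy)] at hxy
  · intro y
    by_cases hy : y ∈ ζ.source
    · obtain ⟨v, hv, hvy⟩ := h.surjOn (ζ.map_source hy)
      refine ⟨ζ.symm v, ?_⟩
      rw [transplant_of_mem (ζ.map_target hv), ζ.right_inv hv, hvy, ζ.left_inv hy]
    · exact ⟨y, transplant_of_notMem hy⟩

lemma transplant_eq_self {x : M} (h : φ (ζ x) = ζ x) : transplant ζ φ x = x := by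
  by_cases hx : x ∈ ζ.source
  · rw [transplant_of_mem hx, h, ζ.left_inv hx]
  · exact transplant_of_notMem hx

/-- `φ` is a local diffeomorphism at `y` pulling the standard complex structure back to one that
is compatible with the standard symplectic form. -/
structure CompatibleMapAt (φ : Cn n → Cn n) (y : Cn n) : Prop where
  contDiffAt : ContDiffAt ℝ ∞ φ y
  injective : Function.Injective (fderiv ℝ φ y)
  tame : ∀ v v', fderiv ℝ φ y v' = mulI n (fderiv ℝ φ y v) → v ≠ 0 → 0 < stdForm n ![v, v']
  invariant : ∀ v v' w w', fderiv ℝ φ y v' = mulI n (fderiv ℝ φ y v) →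
    fderiv ℝ φ y w' = mulI n (fderiv ℝ φ y w) → stdForm n ![v', w'] = stdForm n ![v, w]

lemma compatibleMapAt_stretch {a : Fin n → ℝ} {p q : ℝ → ℝ} (h : IsProfile a p q)
    (ha : ∀ i, 0 < a i) {y : Cn n} (hy : y ≠ 0) : CompatibleMapAt (stretch a p q) y := by
  have hf := (hasFDerivAt_stretch h ha hy).fderiv
  have hD : Function.Injective (scale (stretchFactor a p q y)) :=
    scale_injective fun j => (stretchFactor_pos y j).ne'
  refine ⟨contDiffAt_stretch h ha hy, hf ▸ stretch_fderiv_injective h ha hy,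
    fun v v' hv hv0 => ?_, fun v v' w w' hv hw => ?_⟩
  · rw [hf] at hv
    exact rankTwo_tame (h.positivePair ha hy) hD (mulI_scale _) hv hv0
  · rw [hf] at hv hw
    exact rankTwo_compatible (h.positivePair ha hy) hD (mulI_scale _) hv hw

lemma stdForm_mulI_pos {v : Cn n} (hv : v ≠ 0) : 0 < stdForm n ![v, mulI n v] := by
  rw [stdForm_apply, inner_mulI_mulI]
  exact real_inner_self_pos.2 hv

lemma stdForm_mulI_mulI (v w : Cn n) :
    stdForm n ![mulI n v, mulI n w] = stdForm n ![v, w] := by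
  rw [stdForm_apply, stdForm_apply, inner_mulI_mulI]

lemma compatibleMapAt_of_eventuallyEq_id {y : Cn n} (h : φ =ᶠ[𝓝 y] id) :
    CompatibleMapAt φ y := by
  have hf : fderiv ℝ φ y = ContinuousLinearMap.id ℝ (Cn n) := by rw [h.fderiv_eq, fderiv_id]
  refine ⟨contDiffAt_id.congr_of_eventuallyEq h, by rw [hf]; exact Function.injective_id,
    fun v v' hv hv0 => ?_, fun v v' w w' hv hw => ?_⟩
  · rw [hf] at hv
    exact (show v' = mulI n v from hv) ▸ stdForm_mulI_pos hv0
  · rw [hf] at hv hw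
    rw [show v' = mulI n v from hv, show w' = mulI n w from hw, stdForm_mulI_mulI]

end Transplant

/-! ### Admissibility of the pulled back structure on a completion -/

section Assembly

variable {n : ℕ} {M : Type*} [TopologicalSpace M] [ChartedSpace (Cn n) M]

/-- Conditions under which a self-map of `ℂⁿ`, transported by the chart `ζ` and composed with
`glue`, pulls compatible almost complex structures back to admissible ones. -/
structure EndData.IsModel (D : EndData n M) (ζ : OpenPartialHomeomorph M (Cn n))
    (φ : Cn n → Cn n) : Prop where
  mem_maximalAtlas : ζ ∈ IsManifold.maximalAtlas 𝓘(ℝ, Cn n) ∞ M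
  collar_eq : D.collar = ζ.symm
  end_mem : ∀ r ∈ insert 0 D.times, ∀ z ∈ ellipsoidBdry D.a, F (r, z) ∈ ζ.target
  mapsTo : MapsTo φ ζ.target ζ.target
  eventually_id : ∀ x ∉ ζ.source, transplant ζ φ =ᶠ[𝓝 x] id
  compatible : ∀ w, D.glue w ∈ ζ.source → CompatibleMapAt φ (ζ (D.glue w))
  cylindrical : ∃ J', IsSFTAdmissible D.a J' ∧
    ∀ r ∈ insert 0 D.times, ∀ z ∈ ellipsoidBdry D.a, ∀ u : ℝ × Cn n, u.2 ∈ bdryTangent D.a z →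
      fderiv ℝ φ (F (r, z)) (fderiv ℝ F (r, z) (J' (r, z) u)) =
        mulI n (fderiv ℝ φ (F (r, z)) (fderiv ℝ F (r, z) u))

namespace EndData

variable {D : EndData n M} {ζ : OpenPartialHomeomorph M (Cn n)} {φ : Cn n → Cn n}

lemma mdifferentiable_of_mem_maximalAtlas
    (h : ζ ∈ IsManifold.maximalAtlas 𝓘(ℝ, Cn n) ∞ M) :
    ζ.MDifferentiable 𝓘(ℝ, Cn n) 𝓘(ℝ, Cn n) :=
  ⟨(contMDiffOn_of_mem_maximalAtlas h).mdifferentiableOn (by simp),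
    (contMDiffOn_symm_of_mem_maximalAtlas h).mdifferentiableOn (by simp)⟩

lemma IsModel.contMDiff (h : D.IsModel ζ φ) :
    ContMDiff 𝓘(ℝ, Cn n) 𝓘(ℝ, Cn n) ∞ (transplant ζ φ ∘ D.glue) := by
  intro w
  refine ContMDiffAt.comp (I' := 𝓘(ℝ, Cn n)) w ?_ (D.contMDiff_glue w)
  by_cases hw : D.glue w ∈ ζ.source
  · have h1 : ContMDiffAt 𝓘(ℝ, Cn n) 𝓘(ℝ, Cn n) ∞ ζ (D.glue w) :=
      (contMDiffOn_of_mem_maximalAtlas h.mem_maximalAtlas).contMDiffAt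
        (ζ.open_source.mem_nhds hw)
    have h2 : ContMDiffAt 𝓘(ℝ, Cn n) 𝓘(ℝ, Cn n) ∞ ζ.symm (φ (ζ (D.glue w))) :=
      (contMDiffOn_symm_of_mem_maximalAtlas h.mem_maximalAtlas).contMDiffAt
        (ζ.open_target.mem_nhds (h.mapsTo (ζ.map_source hw)))
    have h3 := h2.comp (D.glue w) ((h.compatible w hw).contDiffAt.contMDiffAt.comp (D.glue w) h1)
    refine h3.congr_of_eventuallyEq ?_
    filter_upwards [ζ.open_source.mem_nhds hw] with x hx using transplant_of_mem hx
  · exact contMDiffAt_id.congr_of_eventuallyEq (h.eventually_id _ hw)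

/-- The derivative of the transported map in the chart. -/
lemma IsModel.mfderiv_chart (h : D.IsModel ζ φ) {w : D.Completion} (hw : D.glue w ∈ ζ.source)
    (v : Cn n) :
    mfderiv 𝓘(ℝ, Cn n) 𝓘(ℝ, Cn n) ζ (transplant ζ φ (D.glue w))
        (mfderiv 𝓘(ℝ, Cn n) 𝓘(ℝ, Cn n) (transplant ζ φ ∘ D.glue) w v) =
      fderiv ℝ φ (ζ (D.glue w)) (mfderiv 𝓘(ℝ, Cn n) 𝓘(ℝ, Cn n) ζ (D.glue w) v) := by
  have hζ := mdifferentiable_of_mem_maximalAtlas h.mem_maximalAtlas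
  have hQ := ((h.contMDiff w).mdifferentiableAt (by simp)).hasMFDerivAt
  have h1 := (hζ.mdifferentiableAt
    ((transplant_mem_source_iff h.mapsTo).2 hw)).hasMFDerivAt.comp w hQ
  have h2 := (((h.compatible w hw).contDiffAt.differentiableAt (by simp)).hasFDerivAt
    ).hasMFDerivAt.comp w
    ((hζ.mdifferentiableAt hw).hasMFDerivAt.comp w (D.hasMFDerivAt_glue w))
  -- The two chain rules differentiate the same map near w, since the transplanted map reads as φ in
  -- the chart.
  have h3 := h1.congr_of_eventuallyEq (f₁ := φ ∘ ζ ∘ D.glue) (by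
    filter_upwards [D.isOpenEmbedding_glue.continuous.continuousAt.preimage_mem_nhds
      (ζ.open_source.mem_nhds hw)] with w' hw'
    exact (chart_transplant h.mapsTo hw').symm)
  exact congrArg (fun T : Cn n →L[ℝ] Cn n => T v) (hasMFDerivAt_unique h3 h2)

lemma IsModel.mfderiv_eq_id (h : D.IsModel ζ φ) {w : D.Completion} (hw : D.glue w ∉ ζ.source) :
    mfderiv 𝓘(ℝ, Cn n) 𝓘(ℝ, Cn n) (transplant ζ φ ∘ D.glue) w =
      ContinuousLinearMap.id ℝ (Cn n) := by
  refine ((D.hasMFDerivAt_glue w).congr_of_eventuallyEq ?_).mfderiv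
  filter_upwards [D.isOpenEmbedding_glue.continuous.continuousAt.eventually
    (h.eventually_id _ hw)] with w' hw'
  exact hw'

lemma IsModel.isInvertible (h : D.IsModel ζ φ) (w : D.Completion) :
    (mfderiv 𝓘(ℝ, Cn n) 𝓘(ℝ, Cn n) (transplant ζ φ ∘ D.glue) w).IsInvertible := by
  by_cases hw : D.glue w ∈ ζ.source
  · have hζ := mdifferentiable_of_mem_maximalAtlas h.mem_maximalAtlas
    refine isInvertible_of_injective fun v v' hv => ?_
    have h1 := h.mfderiv_chart hw v
    have h2 := h.mfderiv_chart hw v'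
    have h3 : mfderiv 𝓘(ℝ, Cn n) 𝓘(ℝ, Cn n) (transplant ζ φ ∘ D.glue) w v =
      mfderiv 𝓘(ℝ, Cn n) 𝓘(ℝ, Cn n) (transplant ζ φ ∘ D.glue) w v' := hv
    rw [h3, h2] at h1
    exact (hζ.mfderiv_injective hw ((h.compatible w hw).injective h1)).symm
  · rw [h.mfderiv_eq_id hw]
    exact isInvertible_of_injective Function.injective_id

lemma form_apply (Ω : TwoForm n M) (w : D.Completion) (v v' : Cn n) :
    D.form Ω w ![v, v'] = Ω (D.glue w) ![v, v'] := by
  rw [form, pullbackForm, (D.hasMFDerivAt_glue w).mfderiv]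
  rfl

section

variable {Ω : TwoForm n M} {J : EndField n M} {p₀ : M}

/-- The pulled back almost complex structure in the chart. -/
lemma IsModel.pullbackJ_chart (h : D.IsModel ζ φ) (hζ : IsComplexDarbouxChart Ω J p₀ ζ)
    {w : D.Completion} (hw : D.glue w ∈ ζ.source) (v : Cn n) :
    fderiv ℝ φ (ζ (D.glue w)) (mfderiv 𝓘(ℝ, Cn n) 𝓘(ℝ, Cn n) ζ (D.glue w)
        (pullbackJ (transplant ζ φ ∘ D.glue) J w v)) =
      mulI n (fderiv ℝ φ (ζ (D.glue w)) (mfderiv 𝓘(ℝ, Cn n) 𝓘(ℝ, Cn n) ζ (D.glue w) v)) := by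
  have h1 := h.mfderiv_chart hw (pullbackJ (transplant ζ φ ∘ D.glue) J w v)
  have h2 := mfderiv_pullbackJ (J := J) (h.isInvertible w) v
  have h3 := hζ.holomorphic _ ((transplant_mem_source_iff h.mapsTo).2 hw)
    (mfderiv 𝓘(ℝ, Cn n) 𝓘(ℝ, Cn n) (transplant ζ φ ∘ D.glue) w v)
  rw [← h.mfderiv_chart hw v]
  exact h1.symm.trans ((congrArg (mfderiv 𝓘(ℝ, Cn n) 𝓘(ℝ, Cn n) ζ
    (transplant ζ φ (D.glue w))) h2).trans h3)

lemma form_chart (hζ : IsComplexDarbouxChart Ω J p₀ ζ) {w : D.Completion}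
    (hw : D.glue w ∈ ζ.source) (v v' : Cn n) :
    D.form Ω w ![v, v'] = stdForm n ![mfderiv 𝓘(ℝ, Cn n) 𝓘(ℝ, Cn n) ζ (D.glue w) v,
      mfderiv 𝓘(ℝ, Cn n) 𝓘(ℝ, Cn n) ζ (D.glue w) v'] := by
  rw [form_apply, ← hζ.darboux _ hw]
  refine (ContinuousAlternatingMap.compContinuousLinearMap_apply _ _ _).trans ?_
  refine congrArg (stdForm n) (funext fun i => ?_)
  fin_cases i <;> rfl

lemma IsModel.compatibleAt (h : D.IsModel ζ φ) (hζ : IsComplexDarbouxChart Ω J p₀ ζ)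
    (hJ : ∀ x, CompatibleAt Ω J x) (w : D.Completion) :
    CompatibleAt (D.form Ω) (pullbackJ (transplant ζ φ ∘ D.glue) J) w := by
  by_cases hw : D.glue w ∈ ζ.source
  · have hd := mdifferentiable_of_mem_maximalAtlas h.mem_maximalAtlas
    have hc := h.compatible w hw
    refine ⟨fun v hv => ?_, fun v v' => ?_⟩
    · refine (form_chart hζ hw _ _).symm ▸ hc.tame _ _ (h.pullbackJ_chart hζ hw v) fun h0 => hv ?_
      exact hd.mfderiv_injective hw (h0.trans (map_zero _).symm)
    · exact (form_chart hζ hw _ _).trans ((hc.invariant _ _ _ _ (h.pullbackJ_chart hζ hw v)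
        (h.pullbackJ_chart hζ hw v')).trans (form_chart hζ hw _ _).symm)
  -- Off the chart the transplanted map fixes the point, but the two values of J lie in formally
  -- different tangent spaces; the comparison is made in the model space.
  · have hpt : ∀ y, y = D.glue w → ∀ v : Cn n, (J y v : Cn n) = J (D.glue w) v := by
      rintro _ rfl _; rfl
    have key : ∀ v : Cn n, (pullbackJ (transplant ζ φ ∘ D.glue) J w v : Cn n) =
        J (D.glue w) v := by
      intro v
      have h2 := mfderiv_pullbackJ (J := J) (h.isInvertible w) v
      rw [h.mfderiv_eq_id hw] at h2
      exact h2.trans (hpt _ (transplant_of_notMem hw) v)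
    let Ωw : Cn n [⋀^Fin 2]→L[ℝ] ℝ := Ω (D.glue w)
    refine ⟨fun v hv => ?_, fun v v' => ?_⟩
    · have h1 : 0 < Ωw ![v, J (D.glue w) v] := (hJ (D.glue w)).1 v hv
      rw [← key v] at h1
      exact (form_apply Ω w v _).symm ▸ h1
    · have h1 : Ωw ![J (D.glue w) v, J (D.glue w) v'] = Ωw ![v, v'] := (hJ (D.glue w)).2 v v'
      rw [← key v, ← key v'] at h1
      exact (form_apply Ω w _ _).trans (h1.trans (form_apply Ω w v v').symm)

lemma IsModel.cylindricalOnEnd (h : D.IsModel ζ φ) (hζ : IsComplexDarbouxChart Ω J p₀ ζ) :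
    D.CylindricalOnEnd (pullbackJ (transplant ζ φ ∘ D.glue) J) := by
  obtain ⟨J', hJ', hcyl⟩ := h.cylindrical
  refine ⟨J', hJ', fun r hr z hz w hw u hu => ?_⟩
  have hd := mdifferentiable_of_mem_maximalAtlas h.mem_maximalAtlas
  have ht := h.end_mem r hr z hz
  have hwF : D.glue w = ζ.symm (F (r, z)) := by rw [hw, h.collar_eq]
  have hws : D.glue w ∈ ζ.source := by rw [hwF]; exact ζ.map_target ht
  have hζw : ζ (D.glue w) = F (r, z) := by rw [hwF, ζ.right_inv ht]
  -- In the chart the embedding of the end is just F, because the collar is the inverse chart. The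
  -- cylindrical condition thus becomes the identity on ℂⁿ contained in `IsModel`.
  have hend : ∀ u : ℝ × Cn n, mfderiv 𝓘(ℝ, Cn n) 𝓘(ℝ, Cn n) ζ (D.glue w)
      (D.endDeriv r z w u) = fderiv ℝ F (r, z) u := by
    intro u
    have hF : HasMFDerivAt 𝓘(ℝ, ℝ × Cn n) 𝓘(ℝ, Cn n) (F : ℝ × Cn n → Cn n) (r, z)
        (fderiv ℝ F (r, z)) := (hasFDerivAt_F r z).differentiableAt.hasFDerivAt.hasMFDerivAt
    have hsymm := (hd.mdifferentiableAt_symm ht).hasMFDerivAt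
    have hcol : HasMFDerivAt 𝓘(ℝ, ℝ × Cn n) 𝓘(ℝ, Cn n) (fun p => D.collar (F p)) (r, z)
        ((mfderiv 𝓘(ℝ, Cn n) 𝓘(ℝ, Cn n) ζ.symm (F (r, z))).comp (fderiv ℝ F (r, z))) := by
      rw [h.collar_eq]
      exact hsymm.comp (r, z) hF
    have he : D.endDeriv r z w u =
        mfderiv 𝓘(ℝ, Cn n) 𝓘(ℝ, Cn n) ζ.symm (F (r, z)) (fderiv ℝ F (r, z) u) := by
      have hi : ∀ y : Cn n,
          ((mfderiv 𝓘(ℝ, Cn n) 𝓘(ℝ, Cn n) D.glue w).inverse y : Cn n) = y := by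
        intro y
        rw [(D.hasMFDerivAt_glue w).mfderiv]
        exact congrArg (fun T : Cn n →L[ℝ] Cn n => T y) ContinuousLinearMap.inverse_id
      exact (hi _).trans (congrArg (fun T : ℝ × Cn n →L[ℝ] Cn n => T u) hcol.mfderiv)
    have hc := congrArg (fun T : Cn n →L[ℝ] Cn n => T (fderiv ℝ F (r, z) u))
      (hd.comp_symm_deriv ht)
    rw [he]
    refine Eq.trans ?_ hc
    rw [hwF]
    rfl
  apply hd.mfderiv_injective hws
  apply (h.compatible w hws).injective
  have e1 := h.pullbackJ_chart hζ hws (D.endDeriv r z w u)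
  rw [hend] at e1 ⊢
  refine e1.trans ?_
  rw [hζw]
  exact (hcyl r hr z hz u hu).symm

variable [IsManifold 𝓘(ℝ, Cn n) ∞ M]

lemma IsModel.memJ (h : D.IsModel ζ φ) (hζ : IsComplexDarbouxChart Ω J p₀ ζ)
    (hJ : IsAlmostComplex J) (hΩJ : ∀ x, CompatibleAt Ω J x) :
    D.MemJ Ω (pullbackJ (transplant ζ φ ∘ D.glue) J) where
  almostComplex := hJ.pullback h.contMDiff h.isInvertible
  compatible x := h.compatibleAt hζ hΩJ (D.incl x)
  cylindrical := h.cylindricalOnEnd hζ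

lemma MemJ.memJTame {J : EndField n D.Completion} (h : D.MemJ Ω J) : D.MemJTame Ω J where
  almostComplex := h.almostComplex
  tame x := (h.compatible x).1
  cylindrical := h.cylindrical

end

end EndData

end Assembly

/-! ### The completions of ellipsoids and of their complements -/

section Completions

variable {n : ℕ}

lemma cylindrical_stretch {a : Fin n → ℝ} {p q : ℝ → ℝ} (h : IsProfile a p q)
    (ha : ∀ i, 0 < a i) {r : ℝ} {z : Cn n} (hz : z ∈ ellipsoidBdry a)
    (hp : deriv p (Real.log (H a (F (r, z)))) = 1) (hq : deriv q (Real.log ‖F (r, z)‖) = 1)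
    {u : ℝ × Cn n} (hu : u.2 ∈ bdryTangent a z) :
    fderiv ℝ (stretch a p q) (F (r, z)) (fderiv ℝ F (r, z) (endJ a (r, z) u)) =
      mulI n (fderiv ℝ (stretch a p q) (F (r, z)) (fderiv ℝ F (r, z) u)) := by
  have hz0 := ne_zero_of_mem_bdry hz
  have hF0 : F (r, z) ≠ 0 := smul_ne_zero (Real.exp_pos _).ne' hz0
  rw [(hasFDerivAt_stretch h ha hF0).fderiv, ContinuousLinearMap.comp_apply,
    ContinuousLinearMap.comp_apply, stretchDeriv_F hz hp hq hu,
    stretchDeriv_F hz hp hq (endJ_tangent ha r hz0 u), endMap_endJ ha r hz0, mulI_scale, map_smul, map_smul, map_smul]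

lemma isAlmostComplex_stdJ : IsAlmostComplex (stdJ n) where
  sq _ v := mulI_mulI v
  smooth := by
    intro x₀
    rw [contMDiffAt_hom_bundle]
    refine ⟨contMDiffAt_id, ?_⟩
    refine (contMDiffAt_const (c := mulI n)).congr_of_eventuallyEq
      (Eventually.of_forall fun x => ?_)
    exact inTangentCoordinates_model_space id id (fun _ : Cn n => mulI n) x₀ ▸ rfl

lemma compatibleAt_std (x : Cn n) : CompatibleAt (stdOmega n) (stdJ n) x :=
  ⟨fun _ hv => stdForm_mulI_pos hv, stdForm_mulI_mulI⟩

lemma isComplexDarbouxChart_refl :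
    IsComplexDarbouxChart (stdOmega n) (stdJ n) 0 (OpenPartialHomeomorph.refl (Cn n)) where
  smooth := by
    have h := (contDiffGroupoid ∞ 𝓘(ℝ, Cn n)).chart_mem_maximalAtlas (0 : Cn n)
    rwa [chartAt_self_eq] at h
  mem_source := mem_univ _
  map_point := rfl
  holomorphic x _ v := by
    have h : mfderiv 𝓘(ℝ, Cn n) 𝓘(ℝ, Cn n) (OpenPartialHomeomorph.refl (Cn n)) x =
        ContinuousLinearMap.id ℝ (Cn n) := mfderiv_id
    rw [h]
    rfl
  darboux x _ := by
    have h : mfderiv 𝓘(ℝ, Cn n) 𝓘(ℝ, Cn n) (OpenPartialHomeomorph.refl (Cn n)) x =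
        ContinuousLinearMap.id ℝ (Cn n) := mfderiv_id
    rw [pullbackForm, h]
    rfl

lemma glue_ellipsoidEnd_surjective {a : Fin n → ℝ} (ha : ∀ i, 0 < a i) :
    Function.Surjective (ellipsoidEnd a ha).glue := by
  intro z
  by_cases hz : H a z ≤ 1
  · exact ⟨Sum.inl ⟨z, hz⟩, rfl⟩
  · have hz0 : z ≠ 0 := by
      rintro rfl
      exact hz ((H_zero a).le.trans zero_le_one)
    obtain ⟨w, hw, hFw⟩ := exists_F ha hz0
    exact ⟨Sum.inr ⟨⟨_, Real.log_pos (not_le.mp hz)⟩, ⟨w, hw⟩⟩, hFw⟩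

theorem exists_diffeomorph_ellipsoid (a : Fin n → ℝ) (ha : ∀ i, 0 < a i) :
    ∃ Q : (ellipsoidEnd a ha).Completion ≃ₘ^∞⟮𝓘(ℝ, Cn n), 𝓘(ℝ, Cn n)⟯ Cn n,
      (ellipsoidEnd a ha).MemJTame (stdOmega n) (pullbackJ Q (stdJ n)) ∧
      ∃ δ : ℝ, 0 < δ ∧
        ∀ w, ‖(ellipsoidEnd a ha).glue w‖ < δ → Q w = (ellipsoidEnd a ha).glue w := by
  obtain ⟨p, q, h, hend, ⟨δ, hδ, hid⟩, hsurj⟩ := exists_profile_near_zero ha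
  have hchart := isComplexDarbouxChart_refl (n := n)
  have hmodel : (ellipsoidEnd a ha).IsModel (OpenPartialHomeomorph.refl (Cn n))
      (stretch a p q) := by
    refine ⟨hchart.smooth, rfl, fun _ _ _ _ => mem_univ _, mapsTo_univ _ _,
      fun x hx => absurd (mem_univ x) hx, fun w _ => ?_, endJ a, isSFTAdmissible_endJ ha,
      fun r hr z hz u hu => ?_⟩
    -- The origin lies in this completion, and the logarithms in the formula break down there; the
    -- map is the identity nearby.
    · by_cases hw : (ellipsoidEnd a ha).glue w = 0
      · refine compatibleMapAt_of_eventuallyEq_id ?_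
        change stretch a p q =ᶠ[𝓝 ((ellipsoidEnd a ha).glue w)] id
        rw [hw]
        filter_upwards [Metric.ball_mem_nhds 0 hδ] with x hx
        exact hid x (by simpa using hx)
      · exact compatibleMapAt_stretch h ha hw
    · have hr0 : 0 ≤ r := by
        rcases hr with rfl | hr
        · exact le_rfl
        · exact le_of_lt hr
      have hz1 : H a z = 1 := hz
      have hH : 1 ≤ H a (F (r, z)) := by
        rw [H_F, hz1, mul_one]
        exact Real.one_le_exp hr0
      exact cylindrical_stretch h ha hz (hend _ hH).1 (hend _ hH).2 hu
  have hbij : Function.Bijective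
      (transplant (OpenPartialHomeomorph.refl (Cn n)) (stretch a p q)) :=
    transplant_bijective (bijOn_univ.2 ⟨stretch_injective h ha, hsurj⟩)
  obtain ⟨Q, hQ⟩ := exists_diffeomorph hmodel.contMDiff hmodel.isInvertible
    (hbij.comp ⟨(ellipsoidEnd a ha).glue_injective, glue_ellipsoidEnd_surjective ha⟩)
  refine ⟨Q, ?_, δ, hδ, fun w hw => ?_⟩
  · rw [hQ]
    exact (hmodel.memJ hchart isAlmostComplex_stdJ compatibleAt_std).memJTame
  · rw [hQ]
    exact transplant_eq_self (hid _ hw)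

section Complement

variable {M : Type*} [TopologicalSpace M] [T2Space M]

lemma range_glue_complementEnd {ζ : OpenPartialHomeomorph M (Cn n)} {a : Fin n → ℝ}
    (ha : ∀ i, 0 < a i) (hζ : ellipsoid a ⊆ ζ.target) :
    range (complementEnd ζ a ha hζ).glue = {ζ.symm 0}ᶜ := by
  have hsub : openEllipsoid a ⊆ ζ.target := fun z (hz : H a z < 1) => hζ (le_of_lt hz)
  have h0 : (0 : Cn n) ∈ openEllipsoid a := by
    change H a 0 < 1
    rw [H_zero]
    exact zero_lt_one
  ext x
  constructor
  · rintro ⟨⟨x, hx⟩ | ⟨⟨r, hr⟩, ⟨z, hz⟩⟩, rfl⟩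
    · rintro rfl
      exact hx ⟨0, h0, rfl⟩
    · intro h
      have hH : H a (F (r, z)) = Real.exp r := by rw [H_F, show H a z = 1 from hz, mul_one]
      have hlt : H a (F (r, z)) ≤ 1 := by rw [hH]; exact Real.exp_le_one_iff.mpr (le_of_lt hr)
      have h' : F (r, z) = 0 := ζ.symm.injOn (hζ hlt) (hsub h0) h
      rw [h', H_zero] at hH
      exact (Real.exp_pos r).ne hH
  · intro hx
    by_cases hx' : x ∈ ζ.symm '' openEllipsoid a
    · obtain ⟨z, hz, rfl⟩ := hx'
      have hz0 : z ≠ 0 := by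
        rintro rfl
        exact hx rfl
      obtain ⟨w, hw, hFw⟩ := exists_F ha hz0
      exact ⟨Sum.inr ⟨⟨_, Real.log_neg (H_pos ha hz0) hz⟩, ⟨w, hw⟩⟩, congrArg ζ.symm hFw⟩
    · exact ⟨Sum.inl ⟨x, hx'⟩, rfl⟩

variable [ChartedSpace (Cn n) M] [IsManifold 𝓘(ℝ, Cn n) ∞ M]

/-- The diffeomorphism from the completed complement of an ellipsoid to the complement of its
centre, supported in a Darboux ball. -/
theorem exists_diffeomorph_complement {Ω : TwoForm n M} {J : EndField n M} {p₀ : M}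
    {ζ : OpenPartialHomeomorph M (Cn n)} (hJ : IsAlmostComplex J)
    (hΩJ : ∀ x, CompatibleAt Ω J x) (hchart : IsComplexDarbouxChart Ω J p₀ ζ)
    {a : Fin n → ℝ} (ha : ∀ i, 0 < a i) {β B : ℝ} (hβ : 0 < β) (hβB : β ≤ B)
    (hf : ∀ j, β ≤ freq a j ∧ freq a j ≤ B)
    (hball : Metric.closedBall 0 (Real.exp (3 + Real.log (B / 2) / 2 - Real.log (β / 2)))
      ⊆ ζ.target) :
    ∃ hζ : ellipsoid a ⊆ ζ.target,
    ∃ Q : (complementEnd ζ a ha hζ).Completion ≃ₘ^∞⟮𝓘(ℝ, Cn n), 𝓘(ℝ, Cn n)⟯ puncture p₀,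
      (complementEnd ζ a ha hζ).MemJ Ω (pullbackJ (fun w => (Q w : M)) J) ∧
      ∀ w, Real.exp (3 + Real.log (B / 2) / 2 - Real.log (β / 2)) ≤
          ‖ζ ((complementEnd ζ a ha hζ).glue w)‖ →
        (Q w : M) = (complementEnd ζ a ha hζ).glue w := by
  obtain ⟨p, q, h, hend, hid, hsurj⟩ := exists_profile_near_infinity ha hβ hβB hf
  have hlog : Real.log (β / 2) ≤ Real.log (B / 2) :=
    Real.log_le_log (half_pos hβ) (by linarith)
  set R := Real.exp (3 + Real.log (B / 2) / 2 - Real.log (β / 2)) with hR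
  have hinj := stretch_injective h ha
  have hball' : ∀ y : Cn n, ‖y‖ ≤ R → y ∈ ζ.target := fun y hy => hball (by simpa using hy)
  have hζ : ellipsoid a ⊆ ζ.target := by
    intro x hx
    refine hball' x ?_
    by_cases hx0 : x = 0
    · rw [hx0, norm_zero]
      exact (Real.exp_pos _).le
    · rw [hR, ← Real.log_le_iff_le_exp (norm_pos_iff.2 hx0)]
      have h1 := (log_H_bounds (half_pos hβ) (half_pos (hβ.trans_le hβB)) (H_bounds hf) hx0).1
      have h2 := Real.log_nonpos (H_pos ha hx0).le hx
      linarith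
  -- The map is injective and the identity outside a ball contained in the target, so it preserves
  -- the target: an image point outside the ball is itself fixed, hence equals its preimage by
  -- injectivity.
  have hbij : BijOn (stretch a p q) ζ.target ζ.target := by
    refine ⟨fun y hy => ?_, hinj.injOn, fun y hy => ?_⟩
    · rcases le_total R ‖stretch a p q y‖ with hle | hle
      · rwa [hinj (hid _ hle)]
      · exact hball' _ hle
    · obtain ⟨x, rfl⟩ := hsurj y
      rcases le_total R ‖x‖ with hle | hle
      · rw [hid x hle] at hy
        exact ⟨x, hy, rfl⟩
      · exact ⟨x, hball' x hle, rfl⟩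
  have hp₀ : ζ.symm 0 = p₀ := by rw [← hchart.map_point, ζ.left_inv hchart.mem_source]
  have hrange := range_glue_complementEnd ha hζ
  rw [hp₀] at hrange
  -- Compact in a Hausdorff space. This makes the transplanted map the identity near every point
  -- outside the chart domain, including the frontier.
  have hclosed : IsClosed (ζ.symm '' Metric.closedBall 0 R) :=
    ((isCompact_closedBall _ _).image_of_continuousOn
      (ζ.symm.continuousOn.mono hball)).isClosed
  have hmodel : (complementEnd ζ a ha hζ).IsModel ζ (stretch a p q) := by
    have hle : ∀ r ∈ insert (0 : ℝ) (Iio 0), ∀ z ∈ ellipsoidBdry a, H a (F (r, z)) ≤ 1 := by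
      intro r hr z hz
      have hr0 : r ≤ 0 := by
        rcases hr with rfl | hr
        · exact le_rfl
        · exact le_of_lt hr
      rw [H_F, show H a z = 1 from hz, mul_one]
      exact Real.exp_le_one_iff.2 hr0
    refine ⟨hchart.smooth, rfl, fun r hr z hz => hζ (hle r hr z hz), hbij.mapsTo, fun x hx => ?_,
      fun w hw => ?_, endJ a, isSFTAdmissible_endJ ha, fun r hr z hz u hu => ?_⟩
    · have hxK : x ∈ (ζ.symm '' Metric.closedBall 0 R)ᶜ := by
        rintro ⟨y, hy, rfl⟩
        exact hx (ζ.map_target (hball hy))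
      filter_upwards [hclosed.isOpen_compl.mem_nhds hxK] with y hy
      by_cases hys : y ∈ ζ.source
      · refine transplant_eq_self (hid _ ?_)
        by_contra hlt
        exact hy ⟨ζ y, by simpa using (not_le.1 hlt).le, ζ.left_inv hys⟩
      · exact transplant_of_notMem hys
    -- The completion misses p₀, so the coordinate is nonzero and behaviour of the map at 0 plays no
    -- role.
    · refine compatibleMapAt_stretch h ha fun h0 => ?_
      have hmem : (complementEnd ζ a ha hζ).glue w ∈ ({p₀}ᶜ : Set M) :=
        hrange ▸ mem_range_self w
      exact hmem (by rw [mem_singleton_iff, ← hp₀, ← h0, ζ.left_inv hw])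
    · have hF0 : F (r, z) ≠ 0 := smul_ne_zero (Real.exp_pos _).ne' (ne_zero_of_mem_bdry hz)
      have he := hend _ hF0 (hle r hr z hz)
      exact cylindrical_stretch h ha hz he.1 he.2 hu
  have htb := transplant_bijective hbij
  have hfix : transplant ζ (stretch a p q) p₀ = p₀ :=
    transplant_eq_self (by rw [hchart.map_point, stretch_zero])
  obtain ⟨Q, hQ⟩ := exists_diffeomorph_opens (U := puncture p₀) hmodel.contMDiff
    hmodel.isInvertible (htb.1.comp (complementEnd ζ a ha hζ).glue_injective) (by
      rw [range_comp, hrange, image_compl_eq htb, image_singleton, hfix]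
      rfl)
  refine ⟨hζ, Q, ?_, fun w hw => ?_⟩
  · rw [show (fun w => (Q w : M)) = transplant ζ (stretch a p q) ∘ _ from funext hQ]
    exact hmodel.memJ hchart hJ hΩJ
  · rw [hQ]
    exact transplant_eq_self (hid _ hw)

end Complement

end Completions

end Ellipsoidal

end

open Ellipsoidal
theorem mainTheorem7 {n : ℕ} (a : Fin n → ℝ) (ha : ∀ i, 0 < a i) :
    -- the diffeomorphism `Q⁺ : Ê(a) → ℂⁿ`, the identity near `0`
    (∃ Q : (ellipsoidEnd a ha).Completion ≃ₘ^∞⟮𝓘(ℝ, Cn n), 𝓘(ℝ, Cn n)⟯ Cn n,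
      (ellipsoidEnd a ha).MemJTame (stdOmega n) (pullbackJ Q (stdJ n)) ∧
      ∃ δ : ℝ, 0 < δ ∧ ∀ w, ‖(ellipsoidEnd a ha).glue w‖ < δ → Q w = (ellipsoidEnd a ha).glue w) ∧
    -- the diffeomorphism `Q⁻` onto `ℂⁿ ∖ {0}`, the identity near infinity
    (∃ Q : (affineEnd a ha).Completion ≃ₘ^∞⟮𝓘(ℝ, Cn n), 𝓘(ℝ, Cn n)⟯ puncture (0 : Cn n),
      (affineEnd a ha).MemJTame (stdOmega n)
        (pullbackJ (fun w => (Q w : Cn n)) (stdJ n)) ∧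
      ∃ R : ℝ, 0 < R ∧ ∀ w, R ≤ ‖(affineEnd a ha).glue w‖ → (Q w : Cn n) = (affineEnd a ha).glue w) ∧
    -- closed symplectic manifolds
    (∀ {M : Type*} [TopologicalSpace M] [T2Space M] [CompactSpace M] [ChartedSpace (Cn n) M]
      [IsManifold 𝓘(ℝ, Cn n) ∞ M] (Ω : TwoForm n M) (J : EndField n M) (p₀ : M)
      (ζ : OpenPartialHomeomorph M (Cn n)),
      IsSymplecticForm Ω → IsAlmostComplex J → (∀ x, CompatibleAt Ω J x) →
      IsComplexDarbouxChart Ω J p₀ ζ →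
      ∃ ε₀ : ℝ, 0 < ε₀ ∧ ∀ (ε : ℝ) (hε : 0 < ε), ε < ε₀ →
        ∃ hζ : ellipsoid (fun i => ε * a i) ⊆ ζ.target,
        ∃ Q : (complementEnd ζ (fun i => ε * a i) (fun i => mul_pos hε (ha i)) hζ).Completion
            ≃ₘ^∞⟮𝓘(ℝ, Cn n), 𝓘(ℝ, Cn n)⟯ puncture p₀,
          (complementEnd ζ (fun i => ε * a i) (fun i => mul_pos hε (ha i)) hζ).MemJ Ω
            (pullbackJ (fun w => (Q w : M)) J)) := by
  refine ⟨exists_diffeomorph_ellipsoid a ha, ?_, ?_⟩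
  · obtain ⟨β, B, hβ, hβB, hf⟩ := exists_freq_bounds ha
    obtain ⟨_, Q, hQ, hid⟩ := exists_diffeomorph_complement isAlmostComplex_stdJ
      compatibleAt_std isComplexDarbouxChart_refl ha hβ hβB hf (subset_univ _)
    exact ⟨Q, hQ.memJTame, _, Real.exp_pos _, hid⟩
  · intro M _ _ _ _ _ Ω J p₀ ζ _ hJ hΩJ hchart
    obtain ⟨β, B, hβ, hβB, hf⟩ := exists_freq_bounds ha
    have h0 : (0 : Cn n) ∈ ζ.target := hchart.map_point ▸ ζ.map_source hchart.mem_source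
    obtain ⟨ρ, hρ, hball⟩ := Metric.nhds_basis_closedBall.mem_iff.1 (ζ.open_target.mem_nhds h0)
    -- Replacing a by εa divides the frequency bounds β and B by ε, so the logarithm of the support
    -- radius changes by (log ε)/2. This bound on ε is where the radius reaches ρ.
    refine ⟨Real.exp (2 * (Real.log ρ - (3 + Real.log (B / 2) / 2 - Real.log (β / 2)))),
      Real.exp_pos _, fun ε hε hlt => ?_⟩
    have hf' : ∀ j, β / ε ≤ freq (fun i => ε * a i) j ∧ freq (fun i => ε * a i) j ≤ B / ε := by
      intro j
      have he : freq (fun i => ε * a i) j = freq a j / ε := by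
        rw [freq, freq, div_div, mul_comm ε]
      rw [he]
      exact ⟨div_le_div_of_nonneg_right (hf j).1 hε.le,
        div_le_div_of_nonneg_right (hf j).2 hε.le⟩
    have hR : Metric.closedBall (0 : Cn n)
        (Real.exp (3 + Real.log (B / ε / 2) / 2 - Real.log (β / ε / 2))) ⊆ ζ.target := by
      refine (Metric.closedBall_subset_closedBall ?_).trans hball
      have h1 := (Real.log_lt_iff_lt_exp hε).2 hlt
      rw [← Real.le_log_iff_exp_le hρ, div_right_comm B, div_right_comm β,
        Real.log_div (half_pos (hβ.trans_le hβB)).ne' hε.ne',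
        Real.log_div (half_pos hβ).ne' hε.ne']
      linarith
    obtain ⟨hζ, Q, hQ, -⟩ := exists_diffeomorph_complement hJ hΩJ hchart
      (fun i => mul_pos hε (ha i)) (div_pos hβ hε) (div_le_div_of_nonneg_right hβB hε.le) hf' hR
    exact ⟨hζ, Q, hQ⟩
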